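/- Let $1\le k\le r\le\infty$ with $r\ge 2$, and consider the space of one-parameter $C^k$-families $F=(f_\theta)_{\theta\in[-1,1]}$ of orientation preserving $C^r$-diffeomorphisms of the circle $S^1=\mathbb R/\mathbb Z$. Precisely, fix a set $\Lambda\subset\mathbb Z_{\ge0}^2$ that contains with $(i,j)$ every $(i',j')$ with $i'\le i$, $j'\le j$, that satisfies $(0,j)\in\Lambda\iff j\le r$ and $(i,0)\in\Lambda\iff i\le k$, and that contains all $(i,j)$ with $i+j\le k$ (for instance, $\Lambda=\{i\le k,\ i+j\le r\}$, which for $k=r$ gives the jointly $C^r$ families, or $\Lambda=\{i\le k,\ j\le r\}$). A family is a map $(\theta,x)\mapsto f_\theta(x)$ with a lift $\varphi:[-1,1]\times\mathbb R\to\mathbb R$ such that $\varphi(\theta,x+1)=\varphi(\theta,x)+1$, $\partial_x\varphi>0$, and the derivatives $\partial_\theta^i\partial_x^j\varphi$, $(i,j)\in\Lambda$, exist and are continuous. The space of families carries the topology of uniform convergence of $F$ and of each of its derivatives $\partial_\theta^i\partial_x^j$ with $(i,j)\in\Lambda$. A source of a circle diffeomorphism $f$ is a periodic orbit, hyperbolic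 or not, whose points are asymptotically stable fixed points of $f^{-p}$, where $p$ is the least period of the orbit. For a family $F$ and a rational number $q$, let $a_q(F)\in\{0,1,2,\dots\}\cup\{+\infty\}$ be the maximal number (the supremum over $\theta$) of sources that $f_\theta$ has for a parameter value $\theta\in[-1,1]$ with rotation number $\rho(f_\theta)=q \bmod 1$; set $a_q(F)=0$ if there is no such $\theta$. Then there is a residual set $\widehat{\mathcal R}$ of families such that for each $F\in\widehat{\mathcal R}$ and each rational $q$ the number $a_q(F)$ is finite and locally constant: there is a neighborhood of $F$ in the space of families such that $a_q(G)=a_q(F)$ for every family $G$ in it. In particular, this holds for all the numbers $a_n=a_{q_n}$, where $(q_n)$ is any enumeration of the rational numbers of any segment $J\subset[0,1)$. -/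

import Mathlib

open Set Filter Topology

noncomputable section

namespace CircleFamilies

/-- The circle `ℝ / ℤ`. -/
abbrev S1 : Type := UnitAddCircle

/-- The parameter segment `[-1, 1]`. -/
abbrev I : Set ℝ := Set.Icc (-1) 1

/-- `∂_θ^i ∂_x^j φ` at `(θ, x)`; the parameter derivative is taken within `I`, hence one-sided at
the endpoints. -/
def mixedDeriv (i j : ℕ) (φ : ℝ → ℝ → ℝ) (θ x : ℝ) : ℝ :=
  iteratedDerivWithin i (fun t => iteratedDeriv j (φ t) x) I θ

/-- `∂_θ^i ∂_x^j φ` exists and is continuous on `I × ℝ`. -/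
structure HasContMixedDeriv (i j : ℕ) (φ : ℝ → ℝ → ℝ) : Prop where
  contDiff_phase : ∀ θ ∈ I, ContDiff ℝ j (φ θ)
  contDiffOn_param : ∀ x : ℝ, ContDiffOn ℝ i (fun t => iteratedDeriv j (φ t) x) I
  continuousOn : ContinuousOn (fun p : ℝ × ℝ => mixedDeriv i j φ p.1 p.2) (I ×ˢ univ)

/-- `Λ` is an admissible set of orders `(i, j)` of the mixed derivatives `∂_θ^i ∂_x^j` required to
be continuous for `C^k`-families of `C^r`-diffeomorphisms: pure phase derivatives up to order `r`,
pure parameter derivatives up to order `k`, at least joint `C^k`-smoothness, and with every order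
all the smaller ones. This covers all the usual conventions: `i ≤ k, i + j ≤ r` (for `k = r`:
jointly `C^r` families), `i ≤ k, j ≤ r` (a `C^k`-curve of `C^r`-diffeomorphisms), and jointly
`C^k` families depending continuously on the parameter in `C^r`. -/
structure IsOrderSet (k r : ℕ∞) (Λ : Set (ℕ × ℕ)) : Prop where
  isLowerSet : IsLowerSet Λ
  phase_mem_iff : ∀ j : ℕ, (0, j) ∈ Λ ↔ (j : ℕ∞) ≤ r
  param_mem_iff : ∀ i : ℕ, (i, 0) ∈ Λ ↔ (i : ℕ∞) ≤ k
  joint_mem : ∀ i j : ℕ, ((i + j : ℕ) : ℕ∞) ≤ k → (i, j) ∈ Λ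

theorem isOrderSet_total {k r : ℕ∞} (h : k ≤ r) :
    IsOrderSet k r {p | (p.1 : ℕ∞) ≤ k ∧ ((p.1 + p.2 : ℕ) : ℕ∞) ≤ r} where
  isLowerSet := by
    rintro ⟨a, b⟩ ⟨c, d⟩ ⟨h1, h2⟩ ⟨h3, h4⟩
    simp only at h1 h2
    exact ⟨le_trans (by exact_mod_cast h1) h3,
      le_trans (by exact_mod_cast Nat.add_le_add h1 h2) h4⟩
  phase_mem_iff j := by simp
  param_mem_iff i := by simpa using fun hi => hi.trans h
  joint_mem i j hij :=
    ⟨le_trans (by exact_mod_cast Nat.le_add_right i j) hij, hij.trans h⟩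

theorem isOrderSet_prod {k r : ℕ∞} (h : k ≤ r) :
    IsOrderSet k r {p | (p.1 : ℕ∞) ≤ k ∧ (p.2 : ℕ∞) ≤ r} where
  isLowerSet := by
    rintro ⟨a, b⟩ ⟨c, d⟩ ⟨h1, h2⟩ ⟨h3, h4⟩
    simp only at h1 h2
    exact ⟨le_trans (by exact_mod_cast h1) h3, le_trans (by exact_mod_cast h2) h4⟩
  phase_mem_iff j := by simp
  param_mem_iff i := by simp
  joint_mem i j hij :=
    ⟨le_trans (by exact_mod_cast Nat.le_add_right i j) hij,
      (le_trans (by exact_mod_cast Nat.le_add_left j i) hij).trans h⟩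

/-- `φ` (restricted to `I × ℝ`) is a lift of the family `f` of circle maps which has the regularity
described by `Λ` and whose members are increasing diffeomorphisms of the line commuting with the
unit translation. -/
structure IsFamilyLift (Λ : Set (ℕ × ℕ)) (f : I → S1 ≃ₜ S1) (φ : ℝ → ℝ → ℝ) : Prop where
  lift : ∀ (θ : I) (x : ℝ), ((φ θ x : ℝ) : S1) = f θ (x : S1)
  add_one : ∀ (θ : I) (x : ℝ), φ θ (x + 1) = φ θ x + 1
  deriv_pos : ∀ (θ : I) (x : ℝ), 0 < deriv (φ θ) x
  smooth : ∀ i j : ℕ, (i, j) ∈ Λ → HasContMixedDeriv i j φ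

/-- A one-parameter family `(f_θ)`, `θ ∈ [-1, 1]`, of orientation preserving circle
diffeomorphisms, of the regularity described by `Λ`. -/
structure Family (Λ : Set (ℕ × ℕ)) where
  map : I → S1 ≃ₜ S1
  exists_lift : ∃ φ : ℝ → ℝ → ℝ, IsFamilyLift Λ map φ

/-- A lift of the family; it is unique up to an integer constant. -/
def Family.lift {Λ : Set (ℕ × ℕ)} (F : Family Λ) : ℝ → ℝ → ℝ := F.exists_lift.choose

/-- The family as a map `I × S¹ → S¹`, together with its mixed derivatives of the nonzero orders in
`Λ` (these do not depend on the lift), all with the topology of uniform convergence. -/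
def Family.jet {Λ : Set (ℕ × ℕ)} (F : Family Λ) :
    (UniformFun (I × S1) S1) × ({p : ℕ × ℕ // p ∈ Λ ∧ p ≠ (0, 0)} → UniformFun (I × ℝ) ℝ) :=
  (UniformFun.ofFun fun z => F.map z.1 z.2,
    fun p => UniformFun.ofFun fun z => mixedDeriv p.1.1 p.1.2 F.lift z.1 z.2)

/-- The `C^Λ`-topology: uniform convergence of the family and of each of its mixed derivatives of
an order in `Λ`. -/
instance (Λ : Set (ℕ × ℕ)) : TopologicalSpace (Family Λ) :=
  TopologicalSpace.induced Family.jet inferInstance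

/-- The rotation number of `f`, an element of `ℝ / ℤ`, is `ρ`: the translation number of a monotone
degree one lift of `f` is congruent to `ρ` modulo one. -/
def HasRotationNumber (f : S1 ≃ₜ S1) (ρ : S1) : Prop :=
  ∃ L : CircleDeg1Lift, (∀ x : ℝ, ((L x : ℝ) : S1) = f (x : S1)) ∧
    ((L.translationNumber : ℝ) : S1) = ρ

/-- `x` is an asymptotically stable fixed point of `g`. -/
structure IsAsymptoticallyStable (g : S1 → S1) (x : S1) : Prop where
  isFixedPt : Function.IsFixedPt g x
  stable : ∀ V ∈ 𝓝 x, ∃ U ∈ 𝓝 x, ∀ y ∈ U, ∀ n : ℕ, g^[n] y ∈ V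
  attracting : ∀ᶠ y in 𝓝 x, Tendsto (fun n : ℕ => g^[n] y) atTop (𝓝 x)

/-- `x` lies on a source of `f`, hyperbolic or not: it is periodic, of least period `p`, and
asymptotically stable under the inverse of `f^p`. -/
def IsSourcePoint (f : S1 ≃ₜ S1) (x : S1) : Prop :=
  x ∈ Function.periodicPts f ∧
    IsAsymptoticallyStable (f.symm)^[Function.minimalPeriod f x] x

/-- The sources of `f`: the repelling periodic orbits. -/
def sources (f : S1 ≃ₜ S1) : Set (Set S1) :=
  {O | ∃ x, IsSourcePoint f x ∧ O = Set.range fun n : ℕ => f^[n] x}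

/-- The maximal number of sources that coexist in the family for a parameter value at which the
rotation number is `ρ` (zero if there is no such parameter value). -/
def Family.maxSources {Λ : Set (ℕ × ℕ)} (F : Family Λ) (ρ : S1) : ℕ∞ :=
  ⨆ (θ : I) (_ : HasRotationNumber (F.map θ) ρ), (sources (F.map θ)).encard

end CircleFamilies

end

noncomputable section

namespace CircleFamilies

/-! ### Lifts of circle homeomorphisms -/

/-- `g` is an increasing continuous lift of the circle homeomorphism `f`. -/
structure IsCircleLift (f : S1 ≃ₜ S1) (g : ℝ → ℝ) : Prop where
  lift : ∀ x : ℝ, ((g x : ℝ) : S1) = f (x : S1)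
  add_one : ∀ x : ℝ, g (x + 1) = g x + 1
  strictMono : StrictMono g
  continuous : Continuous g

/-- A monotone degree one map of the line, bundled as a `CircleDeg1Lift`. -/
def toDeg1Lift (g : ℝ → ℝ) (hm : Monotone g) (h1 : ∀ x, g (x + 1) = g x + 1) : CircleDeg1Lift :=
  ⟨⟨g, hm⟩, h1⟩

theorem surjective_of_add_one {g : ℝ → ℝ} (hc : Continuous g) (hm : Monotone g)
    (h1 : ∀ x, g (x + 1) = g x + 1) : Function.Surjective g :=
  hc.surjective (toDeg1Lift g hm h1).tendsto_atTop (toDeg1Lift g hm h1).tendsto_atBot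

theorem coe_eq_coe_iff {x y : ℝ} : (x : S1) = y ↔ ∃ n : ℤ, x = y + n := by
  rw [← sub_eq_zero, ← AddCircle.coe_sub, AddCircle.coe_eq_zero_iff]
  simp only [zsmul_eq_mul, mul_one]
  exact exists_congr fun n => ⟨fun h => by linarith, fun h => by linarith⟩

theorem exists_homeomorph_of_lift {g : ℝ → ℝ} (hc : Continuous g) (hm : StrictMono g)
    (h1 : ∀ x, g (x + 1) = g x + 1) : ∃ f : S1 ≃ₜ S1, ∀ x : ℝ, ((g x : ℝ) : S1) = f (x : S1) := by
  let e : ℝ ≃o ℝ := hm.orderIsoOfSurjective g (surjective_of_add_one hc hm.monotone h1)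
  have he : ∀ x, e x = g x := fun x => rfl
  have hp : Function.Periodic (fun x => ((g x : ℝ) : S1)) 1 := fun x => by
    simp [h1]
  have hs : ∀ x, e.symm (x + 1) = e.symm x + 1 := fun x => by
    rw [OrderIso.symm_apply_eq, he, h1, ← he, OrderIso.apply_symm_apply]
  have hq : Function.Periodic (fun x => ((e.symm x : ℝ) : S1)) 1 := fun x => by
    simp [hs]
  refine ⟨⟨⟨hp.lift, hq.lift, ?_, ?_⟩, ?_, ?_⟩, fun x => rfl⟩
  · intro x
    induction x using QuotientAddGroup.induction_on with
    | H z => change ((e.symm (g z) : ℝ) : S1) = z; rw [← he, OrderIso.symm_apply_apply]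
  · intro x
    induction x using QuotientAddGroup.induction_on with
    | H z => change ((g (e.symm z) : ℝ) : S1) = z; rw [← he, OrderIso.apply_symm_apply]
  · exact continuous_quot_lift _ ((AddCircle.continuous_mk' 1).comp hc)
  · exact continuous_quot_lift _ ((AddCircle.continuous_mk' 1).comp e.symm.continuous)

/-! ### Mixed derivatives -/

theorem mixedDeriv_zero_left (j : ℕ) (φ : ℝ → ℝ → ℝ) (θ x : ℝ) :
    mixedDeriv 0 j φ θ x = iteratedDeriv j (φ θ) x := by
  simp [mixedDeriv]

theorem uniqueDiffOn_I : UniqueDiffOn ℝ I := uniqueDiffOn_Icc (by norm_num)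

/-- `φ` is (the restriction to `I × ℝ` of) a lift of a family of circle diffeomorphisms. -/
structure IsLineFamily (Λ : Set (ℕ × ℕ)) (φ : ℝ → ℝ → ℝ) : Prop where
  add_one : ∀ (θ : I) (x : ℝ), φ θ (x + 1) = φ θ x + 1
  deriv_pos : ∀ (θ : I) (x : ℝ), 0 < deriv (φ θ) x
  smooth : ∀ i j : ℕ, (i, j) ∈ Λ → HasContMixedDeriv i j φ

theorem IsFamilyLift.isLineFamily {Λ : Set (ℕ × ℕ)} {f : I → S1 ≃ₜ S1} {φ : ℝ → ℝ → ℝ}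
    (h : IsFamilyLift Λ f φ) : IsLineFamily Λ φ := ⟨h.add_one, h.deriv_pos, h.smooth⟩

variable {Λ : Set (ℕ × ℕ)}

theorem IsLineFamily.strictMono {φ : ℝ → ℝ → ℝ} (h : IsLineFamily Λ φ) {θ : ℝ} (hθ : θ ∈ I) :
    StrictMono (φ θ) :=
  strictMono_of_deriv_pos fun x => h.deriv_pos ⟨θ, hθ⟩ x

theorem IsLineFamily.differentiable {φ : ℝ → ℝ → ℝ} (h : IsLineFamily Λ φ) {θ : ℝ} (hθ : θ ∈ I) :
    Differentiable ℝ (φ θ) := fun x =>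
  differentiableAt_of_deriv_ne_zero (h.deriv_pos ⟨θ, hθ⟩ x).ne'

theorem IsLineFamily.exists_family {φ : ℝ → ℝ → ℝ} (h : IsLineFamily Λ φ) :
    ∃ F : Family Λ, IsFamilyLift Λ F.map φ := by
  choose f hf using fun θ : I =>
    exists_homeomorph_of_lift (h.differentiable θ.2).continuous (h.strictMono θ.2) (h.add_one θ)
  have : IsFamilyLift Λ f φ := ⟨hf, h.add_one, h.deriv_pos, h.smooth⟩
  exact ⟨⟨f, φ, this⟩, this⟩

theorem IsFamilyLift.isCircleLift {f : I → S1 ≃ₜ S1} {φ : ℝ → ℝ → ℝ}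
    (h : IsFamilyLift Λ f φ) (θ : I) : IsCircleLift (f θ) (φ θ) :=
  ⟨h.lift θ, h.add_one θ, h.isLineFamily.strictMono θ.2,
    (h.isLineFamily.differentiable θ.2).continuous⟩

theorem Family.isFamilyLift_lift (F : Family Λ) : IsFamilyLift Λ F.map F.lift :=
  F.exists_lift.choose_spec

/-- Adding a smooth function of the phase variable. -/
theorem HasContMixedDeriv.mixedDeriv_add_phase {i j : ℕ} {φ : ℝ → ℝ → ℝ}
    (h : HasContMixedDeriv i j φ) {P : ℝ → ℝ} (hP : ContDiff ℝ j P) {θ : ℝ} (hθ : θ ∈ I) (x : ℝ) :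
    mixedDeriv i j (fun t y => φ t y + P y) θ x =
      mixedDeriv i j φ θ x + if i = 0 then iteratedDeriv j P x else 0 := by
  have h1 : EqOn (fun t => iteratedDeriv j (fun y => φ t y + P y) x)
      (fun t => iteratedDeriv j (φ t) x + iteratedDeriv j P x) I := fun t ht =>
    iteratedDeriv_add (f := φ t) (h.contDiff_phase t ht).contDiffAt hP.contDiffAt
  unfold mixedDeriv
  rw [iteratedDerivWithin_congr h1 hθ]
  rcases i with _ | i
  · simp
  · have := iteratedDerivWithin_add (f := fun t => iteratedDeriv j (φ t) x)
      (g := fun _ => iteratedDeriv j P x) hθ uniqueDiffOn_I (h.contDiffOn_param x θ hθ)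
      (contDiffWithinAt_const (n := ((i + 1 : ℕ) : WithTop ℕ∞)))
    rw [show (fun t => iteratedDeriv j (φ t) x + iteratedDeriv j P x) =
      (fun t => iteratedDeriv j (φ t) x) + (fun _ => iteratedDeriv j P x) from rfl, this]
    simp [iteratedDerivWithin_const]

theorem HasContMixedDeriv.add_phase {i j : ℕ} {φ : ℝ → ℝ → ℝ}
    (h : HasContMixedDeriv i j φ) {P : ℝ → ℝ} (hP : ContDiff ℝ j P) :
    HasContMixedDeriv i j (fun t y => φ t y + P y) where
  contDiff_phase θ hθ := (h.contDiff_phase θ hθ).add hP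
  contDiffOn_param x :=
    ((h.contDiffOn_param x).add (contDiffOn_const (c := iteratedDeriv j P x))).congr fun t ht =>
      iteratedDeriv_add (f := φ t) (h.contDiff_phase t ht).contDiffAt hP.contDiffAt
  continuousOn := by
    have : ContinuousOn (fun p : ℝ × ℝ => mixedDeriv i j φ p.1 p.2 +
        if i = 0 then iteratedDeriv j P p.2 else 0) (I ×ˢ univ) := by
      refine h.continuousOn.add ?_
      split_ifs
      · exact ((hP.continuous_iteratedDeriv' j).comp continuous_snd).continuousOn
      · exact continuousOn_const
    exact this.congr fun p hp => h.mixedDeriv_add_phase hP hp.1 p.2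

theorem IsLineFamily.continuousOn_iteratedDeriv {φ : ℝ → ℝ → ℝ} (h : IsLineFamily Λ φ) {j : ℕ}
    (hj : (0, j) ∈ Λ) :
    ContinuousOn (fun p : ℝ × ℝ => iteratedDeriv j (φ p.1) p.2) (I ×ˢ univ) := by
  simpa only [mixedDeriv_zero_left] using (h.smooth 0 j hj).continuousOn

theorem mixedDeriv_add_one {i j : ℕ} {φ : ℝ → ℝ → ℝ}
    (h : HasContMixedDeriv i j φ) (h1 : ∀ (θ : I) (x : ℝ), φ θ (x + 1) = φ θ x + 1)
    {θ : ℝ} (hθ : θ ∈ I) (x : ℝ) :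
    mixedDeriv i j φ θ (x + 1) = mixedDeriv i j φ θ x + if i = 0 ∧ j = 0 then 1 else 0 := by
  have e : mixedDeriv i j φ θ (x + 1) = mixedDeriv i j (fun t y => φ t y + 1) θ x := by
    refine iteratedDerivWithin_congr (fun t ht => ?_) hθ
    simp only
    rw [← congrFun (iteratedDeriv_comp_add_const j (φ t) 1) x]
    congr 1
    ext y
    exact h1 ⟨t, ht⟩ y
  rw [e, h.mixedDeriv_add_phase contDiff_const hθ]
  rcases i with _ | i <;> rcases j with _ | j <;> simp [iteratedDeriv_const]

/-! ### The topology in terms of lifts -/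

theorem exists_int_abs_sub_eq_norm {X : Type*} [TopologicalSpace X] {s : Set X}
    (hs : IsPreconnected s) {d : X → ℝ} (hd : ContinuousOn d s)
    (h : ∀ p ∈ s, ‖((d p : ℝ) : S1)‖ < 1 / 2) {p₀ : X} (hp₀ : p₀ ∈ s) :
    ∀ p ∈ s, |d p - round (d p₀)| = ‖((d p : ℝ) : S1)‖ := by
  have key : ∀ y : ℝ, |y - round (d p₀)| ≤ 1 / 2 → |y - round (d p₀)| = ‖(y : S1)‖ := by
    intro y hy
    have h1 : ((y - round (d p₀) : ℝ) : S1) = y := by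
      rw [coe_eq_coe_iff]
      exact ⟨-round (d p₀), by push_cast; ring⟩
    rw [← h1]
    exact ((AddCircle.norm_coe_eq_abs_iff 1 one_ne_zero).2 (by simpa using hy)).symm
  have hpre := hs.image d hd
  have h0 : |d p₀ - round (d p₀)| ≤ 1 / 2 := abs_sub_round _
  have h0' : |d p₀ - round (d p₀)| < 1 / 2 := by rw [key _ h0]; exact h _ hp₀
  intro p hp
  refine key _ (le_of_not_gt fun hlt => ?_)
  rw [abs_lt] at h0'
  rw [lt_abs] at hlt
  have mid : ∀ y : ℝ, |y - round (d p₀)| = 1 / 2 → y ∉ d '' s := by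
    rintro y hy ⟨z, hz, rfl⟩
    have := h z hz
    rw [← key _ hy.le, hy] at this
    exact lt_irrefl _ this
  rcases hlt with hlt | hlt
  · refine mid (round (d p₀) + 1 / 2) (by norm_num)
      (hpre.Icc_subset ⟨p₀, hp₀, rfl⟩ ⟨p, hp, rfl⟩ ⟨?_, ?_⟩) <;> linarith
  · refine mid (round (d p₀) - 1 / 2) (by rw [sub_sub_cancel_left]; norm_num [abs_of_pos])
      (hpre.Icc_subset ⟨p, hp, rfl⟩ ⟨p₀, hp₀, rfl⟩ ⟨?_, ?_⟩) <;> linarith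

theorem isPreconnected_strip : IsPreconnected (I ×ˢ (univ : Set ℝ)) :=
  isPreconnected_Icc.prod isPreconnected_univ

theorem zero_mem_I : (0 : ℝ) ∈ I := ⟨by norm_num, by norm_num⟩

theorem mixedDeriv_congr {φ ψ : ℝ → ℝ → ℝ} (h : ∀ θ ∈ I, φ θ = ψ θ) (i j : ℕ) {θ : ℝ}
    (hθ : θ ∈ I) (x : ℝ) : mixedDeriv i j φ θ x = mixedDeriv i j ψ θ x :=
  iteratedDerivWithin_congr (fun t ht => by simp only [h t ht]) hθ

theorem IsFamilyLift.continuousOn {f : I → S1 ≃ₜ S1} {φ : ℝ → ℝ → ℝ} (h : IsFamilyLift Λ f φ)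
    (h0 : (0, 0) ∈ Λ) : ContinuousOn (fun p : ℝ × ℝ => φ p.1 p.2) (I ×ˢ univ) := by
  simpa using h.isLineFamily.continuousOn_iteratedDeriv h0

theorem IsFamilyLift.add_int {f : I → S1 ≃ₜ S1} {φ : ℝ → ℝ → ℝ} (h : IsFamilyLift Λ f φ) (n : ℤ) :
    IsFamilyLift Λ f fun θ x => φ θ x + n where
  lift θ x := by rw [← h.lift, coe_eq_coe_iff]; exact ⟨n, rfl⟩
  add_one θ x := by rw [h.add_one]; ring
  deriv_pos θ x := by rw [deriv_add_const]; exact h.deriv_pos θ x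
  smooth i j hij := (h.smooth i j hij).add_phase contDiff_const

theorem norm_coe_sub_eq_dist {f g : I → S1 ≃ₜ S1} {φ ψ : ℝ → ℝ → ℝ} (hφ : IsFamilyLift Λ f φ)
    (hψ : IsFamilyLift Λ g ψ) {θ : ℝ} (hθ : θ ∈ I) (x : ℝ) :
    ‖((φ θ x - ψ θ x : ℝ) : S1)‖ = dist (f ⟨θ, hθ⟩ x) (g ⟨θ, hθ⟩ x) := by
  rw [dist_eq_norm, ← hφ.lift, ← hψ.lift, AddCircle.coe_sub]

theorem IsFamilyLift.exists_int {f g : I → S1 ≃ₜ S1} {φ ψ : ℝ → ℝ → ℝ} (hφ : IsFamilyLift Λ f φ)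
    (hψ : IsFamilyLift Λ g ψ) (h0 : (0, 0) ∈ Λ)
    (h : ∀ (θ : I) (x : S1), dist (f θ x) (g θ x) < 1 / 2) :
    ∀ (θ : ℝ) (hθ : θ ∈ I) (x : ℝ), |φ θ x - ψ θ x - round (φ 0 0 - ψ 0 0)| =
      dist (f ⟨θ, hθ⟩ x) (g ⟨θ, hθ⟩ x) := by
  intro θ hθ x
  have := exists_int_abs_sub_eq_norm isPreconnected_strip
    (d := fun p : ℝ × ℝ => φ p.1 p.2 - ψ p.1 p.2)
    ((hφ.continuousOn h0).sub (hψ.continuousOn h0))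
    (fun p hp => by
      rw [norm_coe_sub_eq_dist hφ hψ hp.1]; exact h _ _) (p₀ := (0, 0)) ⟨zero_mem_I, mem_univ _⟩
    (θ, x) ⟨hθ, mem_univ _⟩
  rw [this, norm_coe_sub_eq_dist hφ hψ hθ]

theorem IsFamilyLift.eq_add_int {f : I → S1 ≃ₜ S1} {φ ψ : ℝ → ℝ → ℝ} (hφ : IsFamilyLift Λ f φ)
    (hψ : IsFamilyLift Λ f ψ) (h0 : (0, 0) ∈ Λ) :
    ∃ n : ℤ, ∀ θ ∈ I, ∀ x : ℝ, φ θ x = ψ θ x + n := by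
  refine ⟨round (φ 0 0 - ψ 0 0), fun θ hθ x => ?_⟩
  have := hφ.exists_int hψ h0 (by simp) θ hθ x
  rw [dist_self, abs_eq_zero] at this
  linarith

theorem mixedDeriv_add_int {i j : ℕ} {φ : ℝ → ℝ → ℝ} (h : HasContMixedDeriv i j φ)
    (hij : (i, j) ≠ (0, 0)) (n : ℤ) {θ : ℝ} (hθ : θ ∈ I) (x : ℝ) :
    mixedDeriv i j (fun θ x => φ θ x + n) θ x = mixedDeriv i j φ θ x := by
  rw [h.mixedDeriv_add_phase contDiff_const hθ]
  rcases i with _ | i <;> rcases j with _ | j <;> simp_all [iteratedDeriv_const]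

theorem IsFamilyLift.mixedDeriv_eq {f : I → S1 ≃ₜ S1} {φ ψ : ℝ → ℝ → ℝ} (hφ : IsFamilyLift Λ f φ)
    (hψ : IsFamilyLift Λ f ψ) (h0 : (0, 0) ∈ Λ) {i j : ℕ} (hij : (i, j) ∈ Λ)
    (hne : (i, j) ≠ (0, 0)) {θ : ℝ} (hθ : θ ∈ I) (x : ℝ) :
    mixedDeriv i j φ θ x = mixedDeriv i j ψ θ x := by
  obtain ⟨n, hn⟩ := hφ.eq_add_int hψ h0
  rw [← mixedDeriv_add_int (hψ.smooth i j hij) hne n hθ]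
  exact mixedDeriv_congr (fun t ht => funext (hn t ht)) i j hθ x

theorem tendsto_nhds_family_iff {ι : Type*} {l : Filter ι} {G : ι → Family Λ} {F : Family Λ} :
    Tendsto G l (𝓝 F) ↔
      TendstoUniformly (fun a (z : I × S1) => (G a).map z.1 z.2) (fun z => F.map z.1 z.2) l ∧
      ∀ i j, (i, j) ∈ Λ → (i, j) ≠ (0, 0) →
        TendstoUniformly (fun a (z : I × ℝ) => mixedDeriv i j (G a).lift z.1 z.2)
          (fun z => mixedDeriv i j F.lift z.1 z.2) l := by
  rw [nhds_induced, tendsto_comap_iff, Prod.tendsto_iff, tendsto_pi_nhds]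
  simp only [UniformFun.tendsto_iff_tendstoUniformly, Subtype.forall, Prod.forall]
  exact ⟨fun h => ⟨h.1, fun i j h1 h2 => h.2 i j ⟨h1, h2⟩⟩,
    fun h => ⟨h.1, fun i j hij => h.2 i j hij.1 hij.2⟩⟩

/-- Uniform convergence of lifts with their mixed derivatives implies convergence of families. -/
theorem tendsto_family_of_lift {ι : Type*} {l : Filter ι} {G : ι → Family Λ} {F : Family Λ}
    {φ : ℝ → ℝ → ℝ} {ψ : ι → ℝ → ℝ → ℝ} (h0 : (0, 0) ∈ Λ) (hφ : IsFamilyLift Λ F.map φ)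
    (hψ : ∀ᶠ a in l, IsFamilyLift Λ (G a).map (ψ a))
    (h : ∀ i j, (i, j) ∈ Λ → TendstoUniformlyOn (fun a (p : ℝ × ℝ) => mixedDeriv i j (ψ a) p.1 p.2)
      (fun p => mixedDeriv i j φ p.1 p.2) l (I ×ˢ univ)) : Tendsto G l (𝓝 F) := by
  rw [tendsto_nhds_family_iff]
  constructor
  · rw [Metric.tendstoUniformly_iff]
    intro ε hε
    filter_upwards [hψ, Metric.tendstoUniformlyOn_iff.1 (h 0 0 h0) ε hε] with a ha1 ha2
    rintro ⟨θ, x⟩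
    induction x using QuotientAddGroup.induction_on with
    | H x =>
      have := ha2 (θ, x) ⟨θ.2, mem_univ _⟩
      simp only [mixedDeriv_zero_left, iteratedDeriv_zero, Real.dist_eq] at this
      refine lt_of_le_of_lt ?_ this
      have := norm_coe_sub_eq_dist hφ ha1 θ.2 x
      refine this.symm.le.trans ?_
      have h2 := AddCircle.norm_eq (1 : ℝ) (x := φ θ x - ψ a θ x)
      rw [h2]
      have h3 := round_le (φ θ x - ψ a θ x) 0
      simpa using h3
  · intro i j hij hne
    rw [Metric.tendstoUniformly_iff]
    intro ε hε
    filter_upwards [hψ, Metric.tendstoUniformlyOn_iff.1 (h i j hij) ε hε] with a ha1 ha2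
    rintro ⟨θ, x⟩
    have := ha2 (θ, x) ⟨θ.2, mem_univ _⟩
    simp only
    rwa [F.isFamilyLift_lift.mixedDeriv_eq hφ h0 hij hne θ.2,
      (G a).isFamilyLift_lift.mixedDeriv_eq ha1 h0 hij hne θ.2]

/-- The lift of `G` closest to `φ` at the origin. -/
def nearLift (φ : ℝ → ℝ → ℝ) (G : Family Λ) : ℝ → ℝ → ℝ := fun θ x =>
  G.lift θ x + ((-round (G.lift 0 0 - φ 0 0) : ℤ) : ℝ)

theorem isFamilyLift_nearLift (φ : ℝ → ℝ → ℝ) (G : Family Λ) :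
    IsFamilyLift Λ G.map (nearLift φ G) :=
  G.isFamilyLift_lift.add_int _

theorem tendstoUniformlyOn_nearLift {F : Family Λ} {φ : ℝ → ℝ → ℝ} (h0 : (0, 0) ∈ Λ)
    (hφ : IsFamilyLift Λ F.map φ) {j : ℕ} (hj : (0, j) ∈ Λ) :
    TendstoUniformlyOn (fun (G : Family Λ) (p : ℝ × ℝ) => iteratedDeriv j (nearLift φ G p.1) p.2)
      (fun p => iteratedDeriv j (φ p.1) p.2) (𝓝 F) (I ×ˢ univ) := by
  obtain ⟨h1, h2⟩ := tendsto_nhds_family_iff.1 (tendsto_id (α := Family Λ) (x := 𝓝 F))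
  rw [Metric.tendstoUniformlyOn_iff]
  intro ε hε
  rcases j with _ | j
  · filter_upwards [Metric.tendstoUniformly_iff.1 h1 (min ε (1 / 2)) (by positivity)] with G hG
    rintro ⟨θ, x⟩ ⟨hθ, -⟩
    have h3 := G.isFamilyLift_lift.exists_int hφ h0 (fun t y => by
      rw [dist_comm]; exact (hG (t, y)).trans_le (min_le_right _ _)) θ hθ x
    have h4 := (hG (⟨θ, hθ⟩, x)).trans_le (min_le_left _ _)
    rw [dist_comm] at h4
    rw [dist_comm, Real.dist_eq]
    simp only [iteratedDeriv_zero, nearLift]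
    rw [show G.lift θ x + ((-round (G.lift 0 0 - φ 0 0) : ℤ) : ℝ) - φ θ x =
      G.lift θ x - φ θ x - round (G.lift 0 0 - φ 0 0) by push_cast; ring, h3]
    exact h4
  · filter_upwards [Metric.tendstoUniformly_iff.1 (h2 0 (j + 1) hj (by simp)) ε hε] with G hG
    rintro ⟨θ, x⟩ ⟨hθ, -⟩
    have h3 := hG (⟨θ, hθ⟩, x)
    simp only [← mixedDeriv_zero_left]
    simp only [id] at h3
    rwa [F.isFamilyLift_lift.mixedDeriv_eq hφ h0 hj (by simp) hθ,
      G.isFamilyLift_lift.mixedDeriv_eq (isFamilyLift_nearLift φ G) h0 hj (by simp) hθ] at h3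

/-- Joint convergence of the phase derivatives of the lifts of nearby families. -/
theorem tendsto_nearLift {F : Family Λ} {φ : ℝ → ℝ → ℝ} (h0 : (0, 0) ∈ Λ)
    (hφ : IsFamilyLift Λ F.map φ) {j : ℕ} (hj : (0, j) ∈ Λ) {θ₀ : ℝ} (hθ₀ : θ₀ ∈ I) (x₀ : ℝ) :
    Tendsto (fun z : (Family Λ × ℝ) × ℝ => iteratedDeriv j (nearLift φ z.1.1 z.1.2) z.2)
      ((𝓝 F ×ˢ 𝓝[I] θ₀) ×ˢ 𝓝 x₀) (𝓝 (iteratedDeriv j (φ θ₀) x₀)) := by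
  have hc : Tendsto (fun p : ℝ × ℝ => iteratedDeriv j (φ p.1) p.2) (𝓝[I] θ₀ ×ˢ 𝓝 x₀)
      (𝓝 (iteratedDeriv j (φ θ₀) x₀)) := by
    have := hφ.isLineFamily.continuousOn_iteratedDeriv hj (θ₀, x₀) ⟨hθ₀, mem_univ _⟩
    rwa [ContinuousWithinAt, nhdsWithin_prod_eq, nhdsWithin_univ] at this
  rw [Metric.tendsto_nhds] at hc ⊢
  intro ε hε
  have hu := Metric.tendstoUniformlyOn_iff.1 (tendstoUniformlyOn_nearLift h0 hφ hj) (ε / 2)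
    (by positivity)
  have e1 : ∀ᶠ z : (Family Λ × ℝ) × ℝ in (𝓝 F ×ˢ 𝓝[I] θ₀) ×ˢ 𝓝 x₀, z.1.2 ∈ I :=
    (tendsto_snd.comp tendsto_fst).eventually (eventually_mem_nhdsWithin)
  have e2 := (tendsto_fst.comp (tendsto_fst (f := 𝓝 F ×ˢ 𝓝[I] θ₀) (g := 𝓝 x₀))).eventually hu
  have e3 := ((tendsto_snd.comp (tendsto_fst (f := 𝓝 F ×ˢ 𝓝[I] θ₀) (g := 𝓝 x₀))).prodMk
    tendsto_snd).eventually (hc (ε / 2) (by positivity))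
  filter_upwards [e1, e2, e3] with z h1 h2 h3
  have h2' := h2 (z.1.2, z.2) ⟨h1, mem_univ _⟩
  simp only [Function.comp] at h2' h3
  rw [dist_comm] at h2'
  calc _ ≤ _ := dist_triangle _ (iteratedDeriv j (φ z.1.2) z.2) _
    _ < ε / 2 + ε / 2 := add_lt_add h2' h3
    _ = ε := by ring

/-! ### Uniform estimates on the strip -/

theorem add_int_of_add_one {g : ℝ → ℝ} {c : ℝ} (h : ∀ x, g (x + 1) = g x + c) (x : ℝ) (n : ℤ) :
    g (x + n) = g x + n * c := by
  have hp : Function.Periodic (fun x => g x - x * c) 1 := fun x => by simp only [h]; ring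
  have := hp.int_mul n x
  simp only [mul_one] at this
  linarith

theorem exists_uniform_phase {m : ℝ → ℝ → ℝ} {c : ℝ}
    (hm : ContinuousOn (fun p : ℝ × ℝ => m p.1 p.2) (I ×ˢ univ))
    (h1 : ∀ θ ∈ I, ∀ x, m θ (x + 1) = m θ x + c) {ε : ℝ} (hε : 0 < ε) :
    ∃ δ > 0, ∀ θ ∈ I, ∀ x y, |x - y| < δ → |m θ x - m θ y| < ε := by
  have hK : IsCompact (I ×ˢ Icc (-1 : ℝ) 2) := isCompact_Icc.prod isCompact_Icc
  have hu := hK.uniformContinuousOn_of_continuous (hm.mono (prod_mono_right (subset_univ _)))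
  obtain ⟨δ, hδ, H⟩ := Metric.uniformContinuousOn_iff.1 hu ε hε
  refine ⟨min δ 1, by positivity, fun θ hθ x y hxy => ?_⟩
  have hx0 := Int.floor_le x
  have hx1 := Int.lt_floor_add_one x
  have hxy1 := hxy.trans_le (min_le_right _ _)
  have hxyδ := hxy.trans_le (min_le_left _ _)
  rw [abs_lt] at hxy1
  have := H (θ, x + ((-⌊x⌋ : ℤ) : ℝ)) ⟨hθ, by push_cast; constructor <;> linarith⟩
    (θ, y + ((-⌊x⌋ : ℤ) : ℝ)) ⟨hθ, by push_cast; constructor <;> linarith⟩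
    (by rw [Prod.dist_eq, dist_self, max_eq_right dist_nonneg, Real.dist_eq, add_sub_add_right_eq_sub]
        exact hxyδ)
  simp only [Real.dist_eq] at this
  rwa [add_int_of_add_one (h1 θ hθ), add_int_of_add_one (h1 θ hθ), add_sub_add_right_eq_sub] at this

theorem mem_range_Icc_of_periodic {m : ℝ → ℝ → ℝ} (h1 : ∀ θ ∈ I, ∀ x, m θ (x + 1) = m θ x)
    {θ : ℝ} (hθ : θ ∈ I) (x : ℝ) : ∃ y ∈ Icc (0 : ℝ) 1, m θ x = m θ y := by
  refine ⟨Int.fract x, ⟨Int.fract_nonneg x, (Int.fract_lt_one x).le⟩, ?_⟩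
  have := add_int_of_add_one (c := 0) (fun x => by simpa using h1 θ hθ x) (Int.fract x) ⌊x⌋
  simpa using this

theorem isCompact_box : IsCompact (I ×ˢ Icc (0 : ℝ) 1) := isCompact_Icc.prod isCompact_Icc

theorem exists_abs_le_of_periodic {m : ℝ → ℝ → ℝ}
    (hm : ContinuousOn (fun p : ℝ × ℝ => m p.1 p.2) (I ×ˢ univ))
    (h1 : ∀ θ ∈ I, ∀ x, m θ (x + 1) = m θ x) : ∃ B, ∀ θ ∈ I, ∀ x, |m θ x| ≤ B := by
  obtain ⟨B, hB⟩ := isCompact_box.exists_bound_of_continuousOn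
    (hm.mono (prod_mono_right (subset_univ _)))
  refine ⟨B, fun θ hθ x => ?_⟩
  obtain ⟨y, hy, e⟩ := mem_range_Icc_of_periodic h1 hθ x
  rw [e]
  exact hB (θ, y) ⟨hθ, hy⟩

theorem exists_pos_le_of_periodic {m : ℝ → ℝ → ℝ}
    (hm : ContinuousOn (fun p : ℝ × ℝ => m p.1 p.2) (I ×ˢ univ))
    (h1 : ∀ θ ∈ I, ∀ x, m θ (x + 1) = m θ x) (hpos : ∀ θ ∈ I, ∀ x, 0 < m θ x) :
    ∃ μ > 0, ∀ θ ∈ I, ∀ x, μ ≤ m θ x := by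
  obtain ⟨p, hp, hmin⟩ := isCompact_box.exists_isMinOn ⟨(0, 0), zero_mem_I, by simp⟩
    (hm.mono (prod_mono_right (subset_univ _)))
  refine ⟨m p.1 p.2, hpos _ hp.1 _, fun θ hθ x => ?_⟩
  obtain ⟨y, hy, e⟩ := mem_range_Icc_of_periodic h1 hθ x
  rw [e]
  exact hmin (show (θ, y) ∈ I ×ˢ Icc (0 : ℝ) 1 from ⟨hθ, hy⟩)

theorem IsLineFamily.iteratedDeriv_add_one {φ : ℝ → ℝ → ℝ} (h : IsLineFamily Λ φ) {j : ℕ}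
    (hj : (0, j + 1) ∈ Λ) {θ : ℝ} (hθ : θ ∈ I) (x : ℝ) :
    iteratedDeriv (j + 1) (φ θ) (x + 1) = iteratedDeriv (j + 1) (φ θ) x := by
  have := mixedDeriv_add_one (h.smooth 0 (j + 1) hj) h.add_one hθ x
  simpa [mixedDeriv_zero_left] using this

theorem IsLineFamily.exists_deriv_ge {φ : ℝ → ℝ → ℝ} (h : IsLineFamily Λ φ) (h01 : (0, 1) ∈ Λ) :
    ∃ μ > 0, ∀ θ ∈ I, ∀ x, μ ≤ deriv (φ θ) x := by
  simp_rw [← iteratedDeriv_one]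
  refine exists_pos_le_of_periodic (m := fun θ x => iteratedDeriv 1 (φ θ) x)
    (h.continuousOn_iteratedDeriv h01) (fun θ hθ => h.iteratedDeriv_add_one h01 hθ)
    fun θ hθ x => ?_
  rw [iteratedDeriv_one]
  exact h.deriv_pos ⟨θ, hθ⟩ x

/-! ### Perturbations depending on the phase only -/

theorem contDiff_sum_mul {ι : Type*} [Fintype ι] {P : ι → ℝ → ℝ} {n : ℕ}
    (hP : ∀ i, ContDiff ℝ n (P i)) (c : ι → ℝ) : ContDiff ℝ n (fun x => ∑ i, c i * P i x) :=
  ContDiff.sum fun i _ => contDiff_const.mul (hP i)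

theorem iteratedDeriv_sum_mul {ι : Type*} [Fintype ι] {P : ι → ℝ → ℝ} {n : ℕ}
    (hP : ∀ i, ContDiff ℝ n (P i)) (c : ι → ℝ) (x : ℝ) :
    iteratedDeriv n (fun x => ∑ i, c i * P i x) x = ∑ i, c i * iteratedDeriv n (P i) x := by
  rw [iteratedDeriv_fun_sum fun i _ => (contDiff_const.mul (hP i)).contDiffAt]
  exact Finset.sum_congr rfl fun i _ => by
    rw [iteratedDeriv_const_mul_field]

theorem iteratedDeriv_periodic {P : ℝ → ℝ} (h : ∀ x, P (x + 1) = P x) (j : ℕ) (x : ℝ) :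
    iteratedDeriv j P (x + 1) = iteratedDeriv j P x := by
  have e : (fun y => P (y + 1)) = P := funext h
  have := congrFun (iteratedDeriv_comp_add_const j P 1) x
  rw [e] at this
  exact this.symm

theorem tendstoUniformly_sum_mul {ι : Type*} [Fintype ι] {P : ι → ℝ → ℝ}
    (hc : ∀ i, Continuous (P i)) (hper : ∀ i x, P i (x + 1) = P i x) {ε : ℝ} (hε : 0 < ε) :
    ∀ᶠ c : ι → ℝ in 𝓝 0, ∀ x, |∑ i, c i * P i x| < ε := by
  have hB : ∀ i, ∃ B, ∀ x, |P i x| ≤ B := fun i => by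
    obtain ⟨B, hB⟩ := exists_abs_le_of_periodic (m := fun _ x => P i x)
      ((hc i).comp continuous_snd).continuousOn (fun _ _ => hper i)
    exact ⟨B, hB 0 zero_mem_I⟩
  choose B hB using hB
  have ht : Tendsto (fun c : ι → ℝ => ∑ i, |c i| * B i) (𝓝 0) (𝓝 0) := by
    have : Continuous (fun c : ι → ℝ => ∑ i, |c i| * B i) := by fun_prop
    simpa using this.tendsto 0
  filter_upwards [ht.eventually (gt_mem_nhds hε)] with c hc x
  calc |∑ i, c i * P i x| ≤ ∑ i, |c i * P i x| := Finset.abs_sum_le_sum_abs _ _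
    _ ≤ ∑ i, |c i| * B i := Finset.sum_le_sum fun i _ => by
        rw [abs_mul]; exact mul_le_mul_of_nonneg_left (hB i x) (abs_nonneg _)
    _ < ε := hc

/-- The lift `φ` perturbed by a linear combination of functions of the phase. -/
def perturb {ι : Type*} [Fintype ι] (φ : ℝ → ℝ → ℝ) (P : ι → ℝ → ℝ) (c : ι → ℝ) : ℝ → ℝ → ℝ :=
  fun θ x => φ θ x + ∑ i, c i * P i x

theorem iteratedDeriv_perturb {ι : Type*} [Fintype ι] {φ : ℝ → ℝ → ℝ} (hφ : IsLineFamily Λ φ)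
    {P : ι → ℝ → ℝ} (hP : ∀ i, ∀ n : ℕ, ContDiff ℝ n (P i)) (c : ι → ℝ) {j : ℕ} (hj : (0, j) ∈ Λ)
    {θ : ℝ} (hθ : θ ∈ I) (x : ℝ) :
    iteratedDeriv j (perturb φ P c θ) x =
      iteratedDeriv j (φ θ) x + ∑ i, c i * iteratedDeriv j (P i) x := by
  have := (hφ.smooth 0 j hj).mixedDeriv_add_phase (contDiff_sum_mul (fun i => hP i j) c) hθ x
  rwa [mixedDeriv_zero_left, mixedDeriv_zero_left, if_pos rfl,
    iteratedDeriv_sum_mul fun i => hP i j] at this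

theorem eventually_isLineFamily_perturb {ι : Type*} [Fintype ι] {φ : ℝ → ℝ → ℝ}
    (h01 : (0, 1) ∈ Λ) (hφ : IsLineFamily Λ φ) {P : ι → ℝ → ℝ}
    (hP : ∀ i, ∀ n : ℕ, ContDiff ℝ n (P i)) (hper : ∀ i x, P i (x + 1) = P i x) :
    ∀ᶠ c : ι → ℝ in 𝓝 0, IsLineFamily Λ (perturb φ P c) := by
  obtain ⟨μ, hμ, hle⟩ := hφ.exists_deriv_ge h01
  filter_upwards [tendstoUniformly_sum_mul (P := fun i => iteratedDeriv 1 (P i))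
    (fun i => (hP i 1).continuous_iteratedDeriv' 1)
    (fun i => iteratedDeriv_periodic (hper i) 1) hμ] with c hc
  refine ⟨fun θ x => ?_, fun θ x => ?_, fun i j hij => ?_⟩
  · simp only [perturb, hφ.add_one, hper]; ring
  · rw [← iteratedDeriv_one, iteratedDeriv_perturb hφ hP c h01 θ.2, iteratedDeriv_one]
    have := hle θ θ.2 x
    have := (abs_lt.1 (hc x)).1
    linarith
  · exact (hφ.smooth i j hij).add_phase (contDiff_sum_mul (fun i => hP i j) c)

theorem exists_perturbation {ι : Type*} [Fintype ι] {F : Family Λ} {φ : ℝ → ℝ → ℝ}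
    (h0 : (0, 0) ∈ Λ) (h01 : (0, 1) ∈ Λ) (hφ : IsFamilyLift Λ F.map φ) {P : ι → ℝ → ℝ}
    (hP : ∀ i, ∀ n : ℕ, ContDiff ℝ n (P i)) (hper : ∀ i x, P i (x + 1) = P i x) :
    ∃ G : (ι → ℝ) → Family Λ, (∀ᶠ c in 𝓝 0, IsFamilyLift Λ (G c).map (perturb φ P c)) ∧
      Tendsto G (𝓝 0) (𝓝 F) := by
  classical
  let G : (ι → ℝ) → Family Λ := fun c =>
    if h : IsLineFamily Λ (perturb φ P c) then h.exists_family.choose else F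
  have hG : ∀ᶠ c in 𝓝 0, IsFamilyLift Λ (G c).map (perturb φ P c) := by
    filter_upwards [eventually_isLineFamily_perturb h01 hφ.isLineFamily hP hper] with c hc
    simp only [G, dif_pos hc]
    exact hc.exists_family.choose_spec
  refine ⟨G, hG, tendsto_family_of_lift h0 hφ hG fun i j hij => ?_⟩
  rw [Metric.tendstoUniformlyOn_iff]
  intro ε hε
  filter_upwards [tendstoUniformly_sum_mul (P := fun i => iteratedDeriv j (P i))
    (fun i => (hP i j).continuous_iteratedDeriv' j)
    (fun i => iteratedDeriv_periodic (hper i) j) hε] with c hc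
  rintro ⟨θ, x⟩ ⟨hθ, -⟩
  have : mixedDeriv i j (perturb φ P c) θ x = mixedDeriv i j φ θ x + _ :=
    (hφ.smooth i j hij).mixedDeriv_add_phase (contDiff_sum_mul (fun i => hP i j) c) hθ x
  rw [dist_comm, Real.dist_eq]
  simp only
  rw [this, add_sub_cancel_left]
  split_ifs
  · rw [iteratedDeriv_sum_mul fun i => hP i j]; exact hc x
  · simpa using hε

/-! ### Steklov averages -/

/-- The average of `g` over `[x, x + h]`. -/
def steklov (h : ℝ) (g : ℝ → ℝ) (x : ℝ) : ℝ := ∫ s in (0 : ℝ)..1, g (x + h * s)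

theorem steklov_eq {h : ℝ} (hh : h ≠ 0) (g : ℝ → ℝ) (x : ℝ) :
    steklov h g x = h⁻¹ * ∫ s in x..(x + h), g s := by
  have := intervalIntegral.integral_comp_add_mul (a := 0) (b := 1) g hh x
  simpa [steklov] using this

theorem hasDerivAt_steklov {h : ℝ} (hh : h ≠ 0) {g : ℝ → ℝ} (hg : Continuous g) (x : ℝ) :
    HasDerivAt (steklov h g) ((g (x + h) - g x) / h) x := by
  have e : steklov h g = fun x => h⁻¹ * ((∫ s in (0 : ℝ)..(x + h), g s) - ∫ s in (0 : ℝ)..x, g s) := by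
    ext x
    rw [steklov_eq hh, intervalIntegral.integral_interval_sub_left] <;>
      exact hg.intervalIntegrable _ _
  rw [e, div_eq_inv_mul]
  refine HasDerivAt.const_mul _ (HasDerivAt.sub ?_ (hg.integral_hasStrictDerivAt 0 x).hasDerivAt)
  exact HasDerivAt.comp_add_const x h (hg.integral_hasStrictDerivAt 0 (x + h)).hasDerivAt

theorem deriv_steklov {h : ℝ} (hh : h ≠ 0) {g : ℝ → ℝ} (hg : ContDiff ℝ 1 g) :
    deriv (steklov h g) = steklov h (deriv g) := by
  ext x
  rw [(hasDerivAt_steklov hh hg.continuous x).deriv, steklov_eq hh,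
    intervalIntegral.integral_deriv_eq_sub (fun y _ => hg.differentiable one_ne_zero y)
      ((hg.continuous_deriv le_rfl).intervalIntegrable _ _), div_eq_inv_mul]

theorem contDiff_steklov_and {h : ℝ} (hh : h ≠ 0) (j : ℕ) : ∀ {g : ℝ → ℝ}, ContDiff ℝ j g →
    ContDiff ℝ j (steklov h g) ∧ iteratedDeriv j (steklov h g) = steklov h (iteratedDeriv j g) := by
  induction j with
  | zero =>
    intro g hg
    refine ⟨contDiff_zero.2 ?_, by simp⟩
    exact continuous_iff_continuousAt.2 fun x => (hasDerivAt_steklov hh hg.continuous x).continuousAt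
  | succ j ih =>
    intro g hg
    have h1 : ContDiff ℝ 1 g := hg.of_le (by exact_mod_cast Nat.le_add_left 1 j)
    obtain ⟨a, b⟩ := ih (g := deriv g) (by
      have : ContDiff ℝ ((j : WithTop ℕ∞) + 1) g := by exact_mod_cast hg
      exact (contDiff_succ_iff_deriv.1 this).2.2)
    rw [← deriv_steklov hh h1] at a b
    constructor
    · have : ContDiff ℝ ((j : WithTop ℕ∞) + 1) (steklov h g) :=
        contDiff_succ_iff_deriv.2 ⟨fun x => (hasDerivAt_steklov hh h1.continuous x).differentiableAt,
          fun hω => by simp at hω, a⟩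
      exact_mod_cast this
    · rw [iteratedDeriv_succ', iteratedDeriv_succ', b]

theorem abs_steklov_sub_le {h : ℝ} {g g' : ℝ → ℝ} (hg : Continuous g) (hg' : Continuous g')
    {x y ε : ℝ} (H : ∀ s ∈ Icc (0 : ℝ) 1, |g (x + h * s) - g' (y + h * s)| ≤ ε) :
    |steklov h g x - steklov h g' y| ≤ ε := by
  unfold steklov
  rw [← intervalIntegral.integral_sub
    (Continuous.intervalIntegrable (by fun_prop) _ _) (Continuous.intervalIntegrable (by fun_prop) _ _)]
  have := intervalIntegral.norm_integral_le_of_norm_le_const (a := 0) (b := 1) (C := ε)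
    (f := fun s => g (x + h * s) - g' (y + h * s)) (fun s hs => by
      rw [uIoc_of_le zero_le_one] at hs
      exact H s ⟨hs.1.le, hs.2⟩)
  simpa using this

theorem abs_steklov_sub_self_le {h : ℝ} {g : ℝ → ℝ} (hg : Continuous g)
    {x ε : ℝ} (H : ∀ s ∈ Icc (0 : ℝ) 1, |g (x + h * s) - g x| ≤ ε) :
    |steklov h g x - g x| ≤ ε := by
  have : steklov h (fun _ => g x) x = g x := by simp [steklov]
  rw [← this]
  exact abs_steklov_sub_le hg continuous_const H

/-- Differentiation under the integral sign, within `I`. -/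
theorem hasDerivWithinAt_integral {g g' : ℝ → ℝ → ℝ}
    (hg : ∀ θ ∈ I, Continuous (g θ))
    (hg' : ContinuousOn (fun p : ℝ × ℝ => g' p.1 p.2) (I ×ˢ univ))
    (hd : ∀ θ ∈ I, ∀ s, HasDerivWithinAt (fun t => g t s) (g' θ s) I θ) {θ : ℝ} (hθ : θ ∈ I) :
    HasDerivWithinAt (fun t => ∫ s in (0 : ℝ)..1, g t s) (∫ s in (0 : ℝ)..1, g' θ s) I θ := by
  obtain ⟨B, hB⟩ := isCompact_box.exists_bound_of_continuousOn
    (hg'.mono (prod_mono_right (subset_univ _)))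
  have hI : Convex ℝ I := convex_Icc _ _
  rw [hasDerivWithinAt_iff_tendsto_slope]
  have e : ∀ t ∈ I, slope (fun t => ∫ s in (0 : ℝ)..1, g t s) θ t =
      ∫ s in (0 : ℝ)..1, slope (fun t => g t s) θ t := fun t ht => by
    simp only [slope_def_field]
    rw [intervalIntegral.integral_div, intervalIntegral.integral_sub
      ((hg t ht).intervalIntegrable _ _) ((hg θ hθ).intervalIntegrable _ _)]
  have ev : ∀ᶠ t in 𝓝[I \ {θ}] θ, t ∈ I :=
    eventually_mem_nhdsWithin.mono fun t ht => ht.1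
  refine Tendsto.congr' (ev.mono fun t ht => (e t ht).symm) ?_
  refine intervalIntegral.tendsto_integral_filter_of_dominated_convergence (fun _ => B) ?_ ?_ ?_ ?_
  · filter_upwards [ev] with t ht
    simp only [slope_def_field]
    exact (((hg t ht).sub (hg θ hθ)).div_const _).aestronglyMeasurable
  · filter_upwards [ev, eventually_mem_nhdsWithin] with t ht ht'
    refine Eventually.of_forall fun s hs => ?_
    rw [uIoc_of_le zero_le_one] at hs
    have hne : 0 < ‖t - θ‖ := norm_pos_iff.2 (sub_ne_zero.2 fun h => ht'.2 h)
    rw [slope_def_field, norm_div, div_le_iff₀ hne]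
    exact hI.norm_image_sub_le_of_norm_hasDerivWithin_le (f' := fun t => g' t s)
      (fun u hu => hd u hu s) (fun u hu => hB (u, s) ⟨hu, hs.1.le, hs.2⟩) hθ ht
  · exact intervalIntegrable_const
  · exact Eventually.of_forall fun s _ => hasDerivWithinAt_iff_tendsto_slope.1 (hd θ hθ s)

theorem HasContMixedDeriv.continuous_phase {i j : ℕ} {φ : ℝ → ℝ → ℝ}
    (h : HasContMixedDeriv i j φ) {θ : ℝ} (hθ : θ ∈ I) : Continuous (mixedDeriv i j φ θ) :=
  h.continuousOn.comp_continuous (f := fun x => (θ, x)) (by fun_prop) fun x => ⟨hθ, mem_univ _⟩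

theorem hasDerivWithinAt_mixedDeriv {i j : ℕ} {φ : ℝ → ℝ → ℝ}
    (h : HasContMixedDeriv (i + 1) j φ) {θ : ℝ} (hθ : θ ∈ I) (x : ℝ) :
    HasDerivWithinAt (fun t => mixedDeriv i j φ t x) (mixedDeriv (i + 1) j φ θ x) I θ := by
  have hd := (h.contDiffOn_param x).differentiableOn_iteratedDerivWithin (m := i)
    (by exact_mod_cast Nat.lt_succ_self i) uniqueDiffOn_I θ hθ
  have := hd.hasDerivWithinAt
  rwa [← iteratedDerivWithin_succ] at this

theorem continuousOn_steklov (h : ℝ) {m : ℝ → ℝ → ℝ}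
    (hm : ContinuousOn (fun p : ℝ × ℝ => m p.1 p.2) (I ×ˢ univ)) :
    ContinuousOn (fun p : ℝ × ℝ => steklov h (m p.1) p.2) (I ×ˢ univ) := by
  rw [continuousOn_iff_continuous_domRestrict]
  refine intervalIntegral.continuous_parametric_intervalIntegral_of_continuous'
    (f := fun (p : ↥(I ×ˢ (univ : Set ℝ))) s => m p.1.1 (p.1.2 + h * s)) ?_ 0 1
  exact hm.comp_continuous (f := fun q : ↥(I ×ˢ (univ : Set ℝ)) × ℝ =>
    (q.1.1.1, q.1.1.2 + h * q.2)) (by fun_prop) fun q => ⟨q.1.2.1, mem_univ _⟩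

/-- The Steklov average of a family in the phase variable. -/
def steklovFamily (h : ℝ) (φ : ℝ → ℝ → ℝ) : ℝ → ℝ → ℝ := fun θ => steklov h (φ θ)

theorem mixedDeriv_steklov {h : ℝ} (hh : h ≠ 0) {φ : ℝ → ℝ → ℝ} {i j : ℕ}
    (hs : ∀ i' ≤ i, HasContMixedDeriv i' j φ) : ∀ i' ≤ i, ∀ θ ∈ I, ∀ x,
    mixedDeriv i' j (steklovFamily h φ) θ x = steklov h (mixedDeriv i' j φ θ) x := by
  intro i'
  induction i' with
  | zero =>
    intro hi θ hθ x
    rw [mixedDeriv_zero_left, steklovFamily,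
      (contDiff_steklov_and hh j ((hs 0 hi).contDiff_phase θ hθ)).2]
    congr 1
  | succ i' ih =>
    intro hi θ hθ x
    have h1 := hs (i' + 1) hi
    have h2 := hs i' (by omega)
    have key := hasDerivWithinAt_integral (g := fun t s => mixedDeriv i' j φ t (x + h * s))
      (g' := fun t s => mixedDeriv (i' + 1) j φ t (x + h * s))
      (fun t ht => (h2.continuous_phase ht).comp (by fun_prop))
      (h1.continuousOn.comp (f := fun p : ℝ × ℝ => (p.1, x + h * p.2)) (by fun_prop)
        fun p hp => ⟨hp.1, mem_univ _⟩)
      (fun t ht s => hasDerivWithinAt_mixedDeriv h1 ht (x + h * s)) hθ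
    have e : mixedDeriv (i' + 1) j (steklovFamily h φ) θ x =
        derivWithin (fun t => mixedDeriv i' j (steklovFamily h φ) t x) I θ := by
      unfold mixedDeriv; rw [iteratedDerivWithin_succ]
    rw [e, derivWithin_congr (fun t ht => ih (by omega) t ht x) (ih (by omega) θ hθ x)]
    exact key.derivWithin (uniqueDiffOn_I θ hθ)

theorem hasContMixedDeriv_steklov {h : ℝ} (hh : h ≠ 0) {φ : ℝ → ℝ → ℝ} {i j : ℕ}
    (hs : ∀ i' ≤ i, HasContMixedDeriv i' j φ) :
    HasContMixedDeriv i j (steklovFamily h φ) where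
  contDiff_phase θ hθ := (contDiff_steklov_and hh j ((hs i le_rfl).contDiff_phase θ hθ)).1
  contDiffOn_param x := by
    have hm : ∀ i' ≤ i, EqOn (iteratedDerivWithin i'
        (fun t => iteratedDeriv j (steklovFamily h φ t) x) I)
        (fun t => ∫ s in (0 : ℝ)..1, mixedDeriv i' j φ t (x + h * s)) I := fun i' hi t ht =>
      mixedDeriv_steklov hh hs i' hi t ht x
    refine contDiffOn_of_continuousOn_differentiableOn_deriv (fun m hmi => ?_) fun m hmi => ?_
    · have hmi : m ≤ i := by exact_mod_cast hmi
      refine ContinuousOn.congr ?_ (hm m hmi)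
      exact (continuousOn_steklov h (hs m hmi).continuousOn).comp (f := fun t => (t, x))
        (by fun_prop) fun t ht => ⟨ht, mem_univ _⟩
    · have hmi : m < i := by exact_mod_cast hmi
      refine DifferentiableOn.congr ?_ (hm m hmi.le)
      intro t ht
      refine (hasDerivWithinAt_integral (g := fun t s => mixedDeriv m j φ t (x + h * s))
        (g' := fun t s => mixedDeriv (m + 1) j φ t (x + h * s))
        (fun t ht => ((hs m hmi.le).continuous_phase ht).comp (by fun_prop))
        ((hs (m + 1) hmi).continuousOn.comp (f := fun p : ℝ × ℝ => (p.1, x + h * p.2)) (by fun_prop)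
          fun p hp => ⟨hp.1, mem_univ _⟩)
        (fun t ht s => hasDerivWithinAt_mixedDeriv (hs (m + 1) hmi) ht (x + h * s))
        ht).differentiableWithinAt
  continuousOn := (continuousOn_steklov h (hs i le_rfl).continuousOn).congr fun p hp =>
    mixedDeriv_steklov hh hs i le_rfl p.1 hp.1 p.2

theorem IsLineFamily.steklov (hΛ : IsLowerSet Λ) (h01 : (0, 1) ∈ Λ) {φ : ℝ → ℝ → ℝ}
    (hφ : IsLineFamily Λ φ) {h : ℝ} (hh : h ≠ 0) : IsLineFamily Λ (steklovFamily h φ) where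
  add_one θ x := by
    have : ∀ s, φ θ (x + 1 + h * s) = φ θ (x + h * s) + 1 := fun s => by
      rw [← hφ.add_one]; ring_nf
    simp only [steklovFamily, CircleFamilies.steklov, this]
    have hc := (hφ.differentiable θ.2).continuous
    rw [intervalIntegral.integral_add (Continuous.intervalIntegrable (by fun_prop) _ _)
      intervalIntegrable_const]
    simp
  deriv_pos θ x := by
    have h1 : ContDiff ℝ 1 (φ θ) := (hφ.smooth 0 1 h01).contDiff_phase θ θ.2
    have hc := h1.continuous_deriv le_rfl
    rw [steklovFamily, deriv_steklov hh h1]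
    unfold CircleFamilies.steklov
    exact intervalIntegral.intervalIntegral_pos_of_pos
      (Continuous.intervalIntegrable (by fun_prop) _ _) (fun s => hφ.deriv_pos θ _) zero_lt_one
  smooth i j hij := hasContMixedDeriv_steklov hh fun i' hi =>
    hφ.smooth i' j (hΛ (show (i', j) ≤ (i, j) from ⟨hi, le_rfl⟩) hij)

theorem exists_family_steklov (hΛ : IsLowerSet Λ) (h01 : (0, 1) ∈ Λ) {F : Family Λ}
    {φ : ℝ → ℝ → ℝ} (hφ : IsFamilyLift Λ F.map φ) {U : Set (Family Λ)} (hU : U ∈ 𝓝 F) :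
    ∃ G ∈ U, ∃ h : ℝ, h ≠ 0 ∧ IsFamilyLift Λ G.map (steklovFamily h φ) := by
  classical
  have h0 : (0, 0) ∈ Λ := hΛ (show ((0, 0) : ℕ × ℕ) ≤ (0, 1) from ⟨le_rfl, Nat.zero_le _⟩) h01
  let G : ℝ → Family Λ := fun h =>
    if hh : h ≠ 0 then (hφ.isLineFamily.steklov hΛ h01 hh).exists_family.choose else F
  have hG : ∀ h ≠ 0, IsFamilyLift Λ (G h).map (steklovFamily h φ) := fun h hh => by
    simp only [G, dif_pos hh]
    exact (hφ.isLineFamily.steklov hΛ h01 hh).exists_family.choose_spec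
  have hne : ∀ᶠ h : ℝ in 𝓝[>] 0, h ≠ 0 := eventually_mem_nhdsWithin.mono fun h hh => ne_of_gt hh
  have ht : Tendsto G (𝓝[>] 0) (𝓝 F) := by
    refine tendsto_family_of_lift h0 hφ (hne.mono hG) fun i j hij => ?_
    rw [Metric.tendstoUniformlyOn_iff]
    intro ε hε
    obtain ⟨δ, hδ, H⟩ := exists_uniform_phase (hφ.smooth i j hij).continuousOn
      (fun θ hθ => mixedDeriv_add_one (hφ.smooth i j hij) hφ.add_one hθ) (half_pos hε)
    filter_upwards [eventually_mem_nhdsWithin, nhdsWithin_le_nhds (gt_mem_nhds hδ)] with h hpos hlt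
    rintro ⟨θ, x⟩ ⟨hθ, -⟩
    have hpos : 0 < h := hpos
    rw [dist_comm, Real.dist_eq, mixedDeriv_steklov hpos.ne' (fun i' hi =>
      hφ.smooth i' j (hΛ (show (i', j) ≤ (i, j) from ⟨hi, le_rfl⟩) hij)) i le_rfl θ hθ]
    refine (abs_steklov_sub_self_le ((hφ.smooth i j hij).continuous_phase hθ)
      fun s hs => (H θ hθ _ _ ?_).le).trans_lt (half_lt_self hε)
    rw [add_sub_cancel_left, abs_of_nonneg (mul_nonneg hpos.le hs.1)]
    nlinarith [hs.1, hs.2]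
  obtain ⟨h, h1, h2⟩ := (hne.and (ht.eventually hU)).exists
  exact ⟨G h, h2, h, h1, hG h h1⟩

/-! ### Lipschitz jets -/

/-- `m` is Lipschitz on the strip `I × ℝ`. -/
def StripLipschitz (m : ℝ → ℝ → ℝ) : Prop :=
  ∃ K, 0 ≤ K ∧ ∀ θ ∈ I, ∀ θ' ∈ I, ∀ x x', |m θ x - m θ' x'| ≤ K * (|θ - θ'| + |x - x'|)

theorem StripLipschitz.congr {m m' : ℝ → ℝ → ℝ} (h : StripLipschitz m)
    (e : ∀ θ ∈ I, ∀ x, m' θ x = m θ x) : StripLipschitz m' := by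
  obtain ⟨K, hK, H⟩ := h
  exact ⟨K, hK, fun θ hθ θ' hθ' x x' => by rw [e θ hθ, e θ' hθ']; exact H θ hθ θ' hθ' x x'⟩

theorem StripLipschitz.diffQuotient {m : ℝ → ℝ → ℝ} (hm : StripLipschitz m) (h : ℝ) :
    StripLipschitz fun θ x => (m θ (x + h) - m θ x) / h := by
  obtain ⟨K, hK, H⟩ := hm
  refine ⟨2 * K / |h|, by positivity, fun θ hθ θ' hθ' x x' => ?_⟩
  have h1 := H θ hθ θ' hθ' (x + h) (x' + h)
  have h2 := H θ hθ θ' hθ' x x'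
  rw [add_sub_add_right_eq_sub] at h1
  rw [← sub_div, abs_div, div_mul_eq_mul_div]
  refine div_le_div_of_nonneg_right ?_ (abs_nonneg _)
  calc |m θ (x + h) - m θ x - (m θ' (x' + h) - m θ' x')|
      = |(m θ (x + h) - m θ' (x' + h)) - (m θ x - m θ' x')| := by ring_nf
    _ ≤ _ := abs_sub _ _
    _ ≤ _ := by linarith

theorem StripLipschitz.steklov {m : ℝ → ℝ → ℝ} (hm : StripLipschitz m)
    (hc : ∀ θ ∈ I, Continuous (m θ)) (h : ℝ) : StripLipschitz (steklovFamily h m) := by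
  obtain ⟨K, hK, H⟩ := hm
  refine ⟨K, hK, fun θ hθ θ' hθ' x x' => abs_steklov_sub_le (hc θ hθ) (hc θ' hθ') fun s _ => ?_⟩
  have := H θ hθ θ' hθ' (x + h * s) (x' + h * s)
  rwa [add_sub_add_right_eq_sub] at this

theorem IsLineFamily.stripLipschitz (h01 : (0, 1) ∈ Λ) (h10 : (1, 0) ∈ Λ) {φ : ℝ → ℝ → ℝ}
    (hφ : IsLineFamily Λ φ) : StripLipschitz φ := by
  obtain ⟨A, hA⟩ := exists_abs_le_of_periodic (m := fun θ x => iteratedDeriv 1 (φ θ) x)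
    (hφ.continuousOn_iteratedDeriv h01) (fun θ hθ => hφ.iteratedDeriv_add_one h01 hθ)
  obtain ⟨B, hB⟩ := exists_abs_le_of_periodic (m := mixedDeriv 1 0 φ)
    (hφ.smooth 1 0 h10).continuousOn
    (fun θ hθ x => by simpa using mixedDeriv_add_one (hφ.smooth 1 0 h10) hφ.add_one hθ x)
  have hA0 : 0 ≤ A := (abs_nonneg _).trans (hA 0 zero_mem_I 0)
  have hB0 : 0 ≤ B := (abs_nonneg _).trans (hB 0 zero_mem_I 0)
  refine ⟨A + B, by positivity, fun θ hθ θ' hθ' x x' => ?_⟩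
  have h1 : |φ θ x - φ θ x'| ≤ A * |x - x'| := by
    refine convex_univ.norm_image_sub_le_of_norm_deriv_le (f := φ θ)
      (fun y _ => hφ.differentiable hθ y) (fun y _ => ?_) (mem_univ x') (mem_univ x)
    rw [← iteratedDeriv_one]
    exact hA θ hθ y
  have h2 : |φ θ x' - φ θ' x'| ≤ B * |θ - θ'| := by
    refine (convex_Icc (-1 : ℝ) 1).norm_image_sub_le_of_norm_hasDerivWithin_le
      (f := fun t => φ t x') (f' := fun t => mixedDeriv 1 0 φ t x')
      (fun t ht => ?_) (fun t ht => hB t ht x') hθ' hθ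
    have := hasDerivWithinAt_mixedDeriv (hφ.smooth 1 0 h10) ht x'
    simpa [mixedDeriv_zero_left] using this
  calc |φ θ x - φ θ' x'| ≤ |φ θ x - φ θ x'| + |φ θ x' - φ θ' x'| := abs_sub_le _ _ _
    _ ≤ (A + B) * (|θ - θ'| + |x - x'|) := by
      nlinarith [abs_nonneg (θ - θ'), abs_nonneg (x - x'),
        mul_nonneg hA0 (abs_nonneg (θ - θ')), mul_nonneg hB0 (abs_nonneg (x - x')),
        hA0, hB0]

/-- Families whose lifts have Lipschitz second jets are dense. -/
theorem exists_family_stripLipschitz (hΛ : IsLowerSet Λ) (h02 : (0, 2) ∈ Λ) (h10 : (1, 0) ∈ Λ)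
    (F : Family Λ) {U : Set (Family Λ)} (hU : U ∈ 𝓝 F) :
    ∃ G ∈ U, ∃ φ, IsFamilyLift Λ G.map φ ∧
      ∀ j ≤ 2, StripLipschitz fun θ x => iteratedDeriv j (φ θ) x := by
  have h01 : (0, 1) ∈ Λ := hΛ (show ((0, 1) : ℕ × ℕ) ≤ (0, 2) from ⟨le_rfl, by norm_num⟩) h02
  obtain ⟨V, hVU, hV, hFV⟩ := mem_nhds_iff.1 hU
  obtain ⟨G₁, hG₁, h₁, hh₁, hφ₁⟩ := exists_family_steklov hΛ h01 F.isFamilyLift_lift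
    (hV.mem_nhds hFV)
  obtain ⟨G₂, hG₂, h₂, hh₂, hφ₂⟩ := exists_family_steklov hΛ h01 hφ₁ (hV.mem_nhds hG₁)
  refine ⟨G₂, hVU hG₂, _, hφ₂, ?_⟩
  have l₀ := F.isFamilyLift_lift.isLineFamily
  have l₁ := hφ₁.isLineFamily
  have l₂ := hφ₂.isLineFamily
  have d₂ : ∀ θ ∈ I, deriv (steklovFamily h₂ (steklovFamily h₁ F.lift) θ) =
      fun x => (steklovFamily h₁ F.lift θ (x + h₂) - steklovFamily h₁ F.lift θ x) / h₂ :=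
    fun θ hθ => funext fun x =>
      (hasDerivAt_steklov hh₂ (l₁.differentiable hθ).continuous x).deriv
  intro j hj
  interval_cases j
  · simpa using l₂.stripLipschitz h01 h10
  · refine ((l₁.stripLipschitz h01 h10).diffQuotient h₂).congr fun θ hθ x => ?_
    rw [iteratedDeriv_one, d₂ θ hθ]
  · refine (((l₀.stripLipschitz h01 h10).diffQuotient h₁).diffQuotient h₂).congr fun θ hθ x => ?_
    rw [iteratedDeriv_succ, iteratedDeriv_one, d₂ θ hθ]
    have d₁ := hasDerivAt_steklov hh₁ (l₀.differentiable hθ).continuous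
    refine HasDerivAt.deriv (HasDerivAt.div_const (HasDerivAt.sub ?_ ?_) _)
    · exact HasDerivAt.comp_add_const x h₂ (d₁ _)
    · exact d₁ _

/-! ### Periodic points of circle homeomorphisms -/

namespace IsCircleLift

variable {f : S1 ≃ₜ S1} {g : ℝ → ℝ}

theorem add_int (h : IsCircleLift f g) (x : ℝ) (n : ℤ) : g (x + n) = g x + n := by
  simpa using add_int_of_add_one h.add_one x n

theorem lift_iterate (h : IsCircleLift f g) (n : ℕ) (x : ℝ) :
    ((g^[n] x : ℝ) : S1) = f^[n] (x : S1) := by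
  induction n with
  | zero => rfl
  | succ n ih => rw [Function.iterate_succ_apply', Function.iterate_succ_apply', h.lift, ih]

theorem iterate_add_int (h : IsCircleLift f g) (n : ℕ) (x : ℝ) (m : ℤ) :
    g^[n] (x + m) = g^[n] x + m := by
  induction n generalizing x with
  | zero => rfl
  | succ n ih => rw [Function.iterate_succ_apply, Function.iterate_succ_apply, h.add_int, ih]

theorem iterate_mul_of_eq (h : IsCircleLift f g) {n : ℕ} {x : ℝ} {m : ℤ}
    (hx : g^[n] x = x + m) (k : ℕ) : g^[n * k] x = x + (k * m : ℤ) := by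
  induction k with
  | zero => simp
  | succ k ih =>
    rw [Nat.mul_succ, Nat.add_comm, Function.iterate_add_apply, ih, h.iterate_add_int, hx]
    push_cast; ring

theorem isPeriodicPt_iff (h : IsCircleLift f g) {n : ℕ} {x : ℝ} :
    Function.IsPeriodicPt f n (x : S1) ↔ ∃ m : ℤ, g^[n] x = x + m := by
  rw [Function.IsPeriodicPt, Function.IsFixedPt, ← h.lift_iterate, coe_eq_coe_iff]

theorem minimalPeriod_eq (h : IsCircleLift f g) {b : ℕ} {m : ℤ}
    (hm : IsCoprime m b) {x : ℝ} (hx : g^[b] x = x + m) :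
    Function.minimalPeriod f (x : S1) = b := by
  have hp : Function.IsPeriodicPt f b (x : S1) := h.isPeriodicPt_iff.2 ⟨m, hx⟩
  obtain ⟨e, he⟩ := hp.minimalPeriod_dvd
  obtain ⟨m', hm'⟩ := h.isPeriodicPt_iff.1 (Function.isPeriodicPt_minimalPeriod f (x : S1))
  have h2 := h.iterate_mul_of_eq hm' e
  rw [← he, hx] at h2
  have h3 : m = e * m' := by
    have := add_left_cancel h2
    exact_mod_cast this
  have h4 : IsUnit (e : ℤ) := hm.isUnit_of_dvd' ⟨m', h3⟩
    ⟨Function.minimalPeriod f (x : S1), by rw [mul_comm]; exact_mod_cast he⟩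
  have h5 : e = 1 := by simpa using Int.isUnit_iff_natAbs_eq.1 h4
  rw [h5, mul_one] at he
  exact he.symm

/-- The lift as a bundled monotone degree one map. -/
def deg1 (h : IsCircleLift f g) : CircleDeg1Lift := toDeg1Lift g h.strictMono.monotone h.add_one

theorem eq_add_int (h : IsCircleLift f g) {L : CircleDeg1Lift}
    (hL : ∀ x : ℝ, ((L x : ℝ) : S1) = f (x : S1)) : ∃ n : ℤ, ∀ x, L x = g x + n := by
  have hn : ∀ x, ∃ n : ℤ, L x = g x + n := fun x => by
    rw [← coe_eq_coe_iff, hL, h.lift]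
  choose n hn using hn
  have n1 : ∀ x, n (x + 1) = n x := fun x => by
    have := hn (x + 1)
    rw [L.map_add_one, h.add_one, hn x] at this
    exact_mod_cast (by linarith : (n (x + 1) : ℝ) = n x)
  have le : ∀ x y, x ≤ y → y < x + 1 → n x ≤ n y := fun x y hxy hyx => by
    have h1 := L.monotone hxy
    have h2 := h.strictMono hyx
    rw [h.add_one] at h2
    rw [hn x, hn y] at h1
    have : (n x : ℝ) < n y + 1 := by linarith
    exact_mod_cast Int.lt_add_one_iff.1 (by exact_mod_cast this)
  have const : ∀ x ∈ Ico (0 : ℝ) 1, n x = n 0 := fun x hx => by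
    rcases hx.1.eq_or_lt with h0 | h0
    · rw [← h0]
    · refine le_antisymm ?_ (le 0 x hx.1 (by linarith [hx.2]))
      have := le x (0 + 1) (by linarith [hx.2]) (by linarith)
      rwa [n1] at this
  refine ⟨n 0, fun x => ?_⟩
  have h1 := hn (Int.fract x)
  rw [const _ ⟨Int.fract_nonneg x, Int.fract_lt_one x⟩] at h1
  have h2 : x = Int.fract x + ⌊x⌋ := (Int.fract_add_floor x).symm
  rw [h2, L.map_add_int, h.add_int, h1]
  ring

theorem iterate_deg1Lift_eq {L : CircleDeg1Lift} {n : ℤ}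
    (hn : ∀ x, L x = g x + n) (k : ℕ) (x : ℝ) : L^[k] x = g^[k] x + (k * n : ℤ) := by
  induction k with
  | zero => simp
  | succ k ih =>
    rw [Function.iterate_succ_apply', ih, L.map_add_int, hn, Function.iterate_succ_apply']
    push_cast; ring

/-- Periodic points of a homeomorphism with rational rotation number. -/
theorem exists_iterate_den_eq (h : IsCircleLift f g) {q : ℚ}
    (hq : HasRotationNumber f ((q : ℝ) : S1)) {x : ℝ}
    (hx : (x : S1) ∈ Function.periodicPts f) :
    ∃ m : ℤ, IsCoprime m q.den ∧ g^[q.den] x = x + m ∧ ∃ l : ℤ, m = q.num + l * q.den := by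
  obtain ⟨L, hL, hτ⟩ := hq
  obtain ⟨n, hn⟩ := h.eq_add_int hL
  obtain ⟨k, hk, hper⟩ := hx
  obtain ⟨m', hm'⟩ := h.isPeriodicPt_iff.1 hper
  obtain ⟨l, hl⟩ := coe_eq_coe_iff.1 hτ
  have hb : (0 : ℝ) < q.den := by exact_mod_cast q.den_pos
  have hk' : (0 : ℝ) < k := by exact_mod_cast hk
  have hLk : L^[k] x = x + (m' + k * n : ℤ) := by
    rw [iterate_deg1Lift_eq hn, hm']; push_cast; ring
  have hτ' : L.translationNumber = (m' + k * n : ℤ) / k :=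
    L.translationNumber_of_map_pow_eq_add_int (by rw [CircleDeg1Lift.coe_pow]; exact hLk) hk
  set a : ℤ := q.num + l * q.den with ha
  have hqv : (q : ℝ) = q.num / q.den := by exact_mod_cast (Rat.num_div_den q).symm
  have hcross : ((m' + k * n : ℤ) : ℝ) * q.den = a * k := by
    rw [hτ', hqv] at hl
    field_simp at hl
    rw [ha]; push_cast at hl ⊢
    linarith
  have hLb : L^[q.den] x = x + a := by
    have e := (CircleDeg1Lift.iterate_pos_eq_iff (L ^ q.den) (x := x) (m := a) hk).1 (by
      rw [CircleDeg1Lift.coe_pow, ← Function.iterate_mul, Nat.mul_comm, Function.iterate_mul]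
      have := (CircleDeg1Lift.iterate_pos_eq_iff (L ^ k) (x := x) (m := m' + k * n) q.den_pos).2
        (by rw [CircleDeg1Lift.coe_pow]; exact hLk)
      rw [CircleDeg1Lift.coe_pow] at this
      rw [this]
      linarith)
    rwa [CircleDeg1Lift.coe_pow] at e
  rw [iterate_deg1Lift_eq hn] at hLb
  refine ⟨q.num + (l - n) * q.den, ?_, ?_, l - n, rfl⟩
  · have : IsCoprime q.num (q.den : ℤ) := by
      rw [Int.isCoprime_iff_gcd_eq_one]; exact q.reduced
    exact IsCoprime.add_mul_right_left_iff.2 this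
  · rw [ha] at hLb; push_cast at hLb ⊢; linarith

theorem hasRotationNumber (h : IsCircleLift f g) {q : ℚ} {x : ℝ} {m l : ℤ}
    (hm : m = q.num + l * q.den) (hx : g^[q.den] x = x + m) :
    HasRotationNumber f ((q : ℝ) : S1) := by
  refine ⟨h.deg1, h.lift, ?_⟩
  have hb : (q.den : ℝ) ≠ 0 := by exact_mod_cast q.den_nz
  rw [h.deg1.translationNumber_of_map_pow_eq_add_int
    (by rw [CircleDeg1Lift.coe_pow]; exact hx) q.den_pos, coe_eq_coe_iff]
  refine ⟨l, ?_⟩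
  have hqv : (q : ℝ) = q.num / q.den := by exact_mod_cast (Rat.num_div_den q).symm
  rw [hqv, hm]
  push_cast
  field_simp

end IsCircleLift

/-! ### Sources -/

theorem exists_iterate_le_of_hasDerivAt {g : ℝ → ℝ} {g' x : ℝ} (hg : HasDerivAt g g' x)
    (hx : g x = x) (h1 : |g'| < 1) : ∃ c ∈ Ico (0 : ℝ) 1, ∃ δ > 0, ∀ y, |y - x| < δ →
      ∀ n : ℕ, |g^[n] y - x| ≤ c ^ n * |y - x| := by
  obtain ⟨c, hc1, hc2⟩ := exists_between h1
  have hc0 : 0 ≤ c := (abs_nonneg _).trans hc1.le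
  have ev : ∀ᶠ y in 𝓝 x, |g y - x| ≤ c * |y - x| := by
    have := (hasDerivAt_iff_isLittleO.1 hg).def (sub_pos.2 hc1)
    filter_upwards [this] with y hy
    rw [hx, smul_eq_mul, Real.norm_eq_abs, Real.norm_eq_abs] at hy
    calc |g y - x| = |(g y - x - (y - x) * g') + (y - x) * g'| := by ring_nf
      _ ≤ |g y - x - (y - x) * g'| + |(y - x) * g'| := abs_add_le _ _
      _ ≤ (c - |g'|) * |y - x| + |y - x| * |g'| := by rw [abs_mul]; linarith
      _ = _ := by ring
  obtain ⟨δ, hδ, H⟩ := Metric.eventually_nhds_iff.1 ev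
  refine ⟨c, ⟨hc0, hc2⟩, δ, hδ, fun y hy n => ?_⟩
  induction n with
  | zero => simp
  | succ n ih =>
    rw [Function.iterate_succ_apply']
    have h2 : |g^[n] y - x| < δ :=
      (ih.trans (mul_le_of_le_one_left (abs_nonneg _) (pow_le_one₀ hc0 hc2.le))).trans_lt hy
    calc _ ≤ c * |g^[n] y - x| := H h2
      _ ≤ c * (c ^ n * |y - x|) := by gcongr
      _ = _ := by ring

theorem tendsto_iterate_of_le {g : ℝ → ℝ} {c x y : ℝ} (hc : c ∈ Ico (0 : ℝ) 1)
    (h : ∀ n : ℕ, |g^[n] y - x| ≤ c ^ n * |y - x|) : Tendsto (fun n => g^[n] y) atTop (𝓝 x) := by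
  rw [tendsto_iff_dist_tendsto_zero]
  refine squeeze_zero (g := fun n => c ^ n * |y - x|) (fun _ => dist_nonneg) h ?_
  simpa using (tendsto_pow_atTop_nhds_zero_of_lt_one hc.1 hc.2).mul_const |y - x|

namespace IsCircleLift

variable {f : S1 ≃ₜ S1} {g : ℝ → ℝ}

theorem iterate_strictMono (h : IsCircleLift f g) (n : ℕ) : StrictMono g^[n] := h.strictMono.iterate n

theorem symm_iterate_iterate (f : S1 ≃ₜ S1) (n : ℕ) (x : S1) : f.symm^[n] (f^[n] x) = x :=
  (Function.LeftInverse.iterate f.symm_apply_apply n) x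

/-- The derivative of the return map at a source is at least one. -/
theorem one_le_of_isAsymptoticallyStable (h : IsCircleLift f g) {b : ℕ} {x g' : ℝ} {m : ℤ}
    (hx : g^[b] x = x + m) (hd : HasDerivAt g^[b] g' x)
    (hs : IsAsymptoticallyStable f.symm^[b] (x : S1)) : 1 ≤ g' := by
  by_contra! hlt
  have hpos : 0 ≤ g' := hd.nonneg_of_monotone (h.iterate_strictMono b).monotone
  let G : ℝ → ℝ := fun y => g^[b] y - m
  obtain ⟨c, hc, δ, hδ, H⟩ := exists_iterate_le_of_hasDerivAt (g := G) (hd.sub_const _)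
    (by simp [G, hx]) (by rwa [abs_of_nonneg hpos])
  have hlift : ∀ n y, ((G^[n] y : ℝ) : S1) = (f^[b])^[n] (y : S1) := fun n y => by
    induction n with
    | zero => rfl
    | succ n ih =>
      rw [Function.iterate_succ_apply', Function.iterate_succ_apply', ← ih, ← h.lift_iterate,
        coe_eq_coe_iff]
      exact ⟨-m, by simp only [G]; push_cast; ring⟩
  set y := x + min (δ / 2) (1 / 2) with hy
  have hmin : 0 < min (δ / 2) (1 / 2) := by positivity
  have hyx : |y - x| = min (δ / 2) (1 / 2) := by rw [hy, add_sub_cancel_left, abs_of_pos hmin]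
  have hne : (y : S1) ≠ x := by
    intro e
    obtain ⟨n, hn⟩ := coe_eq_coe_iff.1 e
    have h1 : min (δ / 2) (1 / 2) = n := by rw [hy] at hn; linarith
    have h2 : (0 : ℝ) < n := h1 ▸ hmin
    have h3 : (n : ℝ) < 1 := h1 ▸ (min_le_right _ _).trans_lt (by norm_num)
    have h2 : 0 < n := by exact_mod_cast h2
    have h3 : n < 1 := by exact_mod_cast h3
    omega
  obtain ⟨U, hU, HU⟩ := hs.stable {(y : S1)}ᶜ (isOpen_compl_singleton.mem_nhds hne.symm)
  have ht : Tendsto (fun n => ((G^[n] y : ℝ) : S1)) atTop (𝓝 (x : S1)) :=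
    ((AddCircle.continuous_mk' (1 : ℝ)).tendsto x).comp
      (tendsto_iterate_of_le hc (H y (by
        rw [hyx]; exact (min_le_left _ _).trans_lt (by linarith))))
  obtain ⟨n, hn⟩ := (ht.eventually hU).exists
  refine HU _ hn n ?_
  rw [hlift, mem_singleton_iff, ← Function.iterate_mul, ← Function.iterate_mul]
  exact symm_iterate_iterate f _ _

/-- A periodic point at which the derivative of the return map exceeds one lies on a source. -/
theorem isSourcePoint_of_one_lt (h : IsCircleLift f g) {b : ℕ} (hb : 0 < b) {x g' : ℝ} {m : ℤ}
    (hm : IsCoprime m b) (hx : g^[b] x = x + m) (hd : HasDerivAt g^[b] g' x) (h1 : 1 < g') :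
    IsSourcePoint f (x : S1) := by
  refine ⟨⟨b, hb, h.isPeriodicPt_iff.2 ⟨m, hx⟩⟩, ?_⟩
  rw [h.minimalPeriod_eq hm hx]
  have hmono : StrictMono fun y => g^[b] y - m := fun y z hyz =>
    sub_lt_sub_right (h.iterate_strictMono b hyz) _
  have hcont : Continuous fun y => g^[b] y - m := (h.continuous.iterate b).sub continuous_const
  let e : ℝ ≃o ℝ := hmono.orderIsoOfSurjective _ (surjective_of_add_one hcont hmono.monotone
    fun y => by have := h.iterate_add_int b y 1; push_cast at this; rw [this]; ring)
  have he : ∀ y, e y = g^[b] y - m := fun y => rfl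
  have hex : e x = x := by rw [he, hx]; ring
  have hesx : e.symm x = x := by rw [OrderIso.symm_apply_eq, hex]
  have hde : HasDerivAt e.symm g'⁻¹ x := by
    refine HasDerivAt.of_local_left_inverse (f := e) e.symm.continuous.continuousAt ?_
      (by positivity) (Eventually.of_forall e.apply_symm_apply)
    rw [hesx]
    exact hd.sub_const _
  obtain ⟨c, hc, δ, hδ, H⟩ := exists_iterate_le_of_hasDerivAt hde hesx (by
    rw [abs_of_pos (by positivity)]; exact inv_lt_one_of_one_lt₀ h1)
  have hlift1 : ∀ y : ℝ, ((e.symm y : ℝ) : S1) = f.symm^[b] (y : S1) := fun y => by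
    rw [← symm_iterate_iterate f b ((e.symm y : ℝ) : S1), ← h.lift_iterate]
    congr 1
    rw [coe_eq_coe_iff]
    refine ⟨m, ?_⟩
    have := e.apply_symm_apply y
    rw [he] at this
    linarith
  have hlift : ∀ n (y : ℝ), ((e.symm^[n] y : ℝ) : S1) = (f.symm^[b])^[n] (y : S1) := fun n y => by
    induction n with
    | zero => rfl
    | succ n ih => rw [Function.iterate_succ_apply', Function.iterate_succ_apply', ← ih, hlift1]
  have hopen : IsOpenMap ((↑) : ℝ → S1) := QuotientAddGroup.isOpenMap_coe
  refine ⟨?_, fun V hV => ?_, ?_⟩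
  · rw [Function.IsFixedPt, ← hlift1, hesx]
  · obtain ⟨ε, hε, hεV⟩ := Metric.mem_nhds_iff.1
      (((AddCircle.continuous_mk' (1 : ℝ)).tendsto x) hV)
    refine ⟨(↑) '' Metric.ball x (min δ ε),
      hopen.image_mem_nhds (Metric.ball_mem_nhds x (by positivity)), ?_⟩
    rintro _ ⟨y, hy, rfl⟩ n
    rw [← hlift]
    rw [Metric.mem_ball, Real.dist_eq] at hy
    refine hεV ?_
    rw [Metric.mem_ball, Real.dist_eq]
    exact ((H y (hy.trans_le (min_le_left _ _)) n).trans (mul_le_of_le_one_left (abs_nonneg _)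
      (pow_le_one₀ hc.1 hc.2.le))).trans_lt (hy.trans_le (min_le_right _ _))
  · have := hopen.image_mem_nhds (Metric.ball_mem_nhds x hδ)
    filter_upwards [this]
    rintro _ ⟨y, hy, rfl⟩
    simp_rw [← hlift]
    rw [Metric.mem_ball, Real.dist_eq] at hy
    exact ((AddCircle.continuous_mk' (1 : ℝ)).tendsto x).comp (tendsto_iterate_of_le hc (H y hy))

end IsCircleLift

/-! ### Second jets of iterates -/

/-- The action of `g` on second jets of functions of one variable. -/
def jetStep (g : ℝ → ℝ) (z : ℝ × ℝ × ℝ) : ℝ × ℝ × ℝ :=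
  (g z.1, iteratedDeriv 1 g z.1 * z.2.1,
    iteratedDeriv 2 g z.1 * z.2.1 ^ 2 + iteratedDeriv 1 g z.1 * z.2.2)

/-- The second jet of `g^[n]` at `u`. -/
def iterJet (g : ℝ → ℝ) (n : ℕ) (u : ℝ) : ℝ × ℝ × ℝ := (jetStep g)^[n] (u, 1, 0)

theorem iterJet_succ (g : ℝ → ℝ) (n : ℕ) (u : ℝ) :
    iterJet g (n + 1) u = jetStep g (iterJet g n u) :=
  Function.iterate_succ_apply' _ _ _

theorem iterJet_fst (g : ℝ → ℝ) (n : ℕ) (u : ℝ) : (iterJet g n u).1 = g^[n] u := by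
  induction n with
  | zero => rfl
  | succ n ih => rw [iterJet_succ, Function.iterate_succ_apply', ← ih]; rfl

theorem iterJet_snd (g : ℝ → ℝ) (n : ℕ) (u : ℝ) :
    (iterJet g n u).2.1 = ∏ i ∈ Finset.range n, deriv g (g^[i] u) := by
  induction n with
  | zero => rfl
  | succ n ih =>
    rw [iterJet_succ, Finset.prod_range_succ, ← ih, ← iterJet_fst, mul_comm, ← iteratedDeriv_one]
    rfl

theorem hasDerivAt_iterJet {g : ℝ → ℝ} (hg : ContDiff ℝ 2 g) (n : ℕ) (u : ℝ) :
    HasDerivAt (fun u => (iterJet g n u).1) (iterJet g n u).2.1 u ∧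
      HasDerivAt (fun u => (iterJet g n u).2.1) (iterJet g n u).2.2 u := by
  have d1 : ∀ y, HasDerivAt g (iteratedDeriv 1 g y) y := fun y => by
    rw [iteratedDeriv_one]
    exact (hg.differentiable two_ne_zero y).hasDerivAt
  have d2 : ∀ y, HasDerivAt (iteratedDeriv 1 g) (iteratedDeriv 2 g y) y := fun y => by
    rw [iteratedDeriv_succ (n := 1)]
    exact (hg.differentiable_iteratedDeriv 1 (by norm_num) y).hasDerivAt
  induction n with
  | zero => exact ⟨hasDerivAt_id u, hasDerivAt_const u 1⟩
  | succ n ih =>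
    simp only [iterJet_succ, jetStep]
    refine ⟨(d1 _).comp u ih.1, ?_⟩
    convert! ((d2 _).comp u ih.1).mul ih.2 using 1
    simp only [Function.comp]
    ring

theorem hasDerivAt_iterate {g : ℝ → ℝ} (hg : ContDiff ℝ 2 g) (n : ℕ) (u : ℝ) :
    HasDerivAt g^[n] (iterJet g n u).2.1 u := by
  have := (hasDerivAt_iterJet hg n u).1
  simp only [iterJet_fst] at this
  exact this

theorem iterJet_snd_pos {g : ℝ → ℝ} (hg : ∀ x, 0 < deriv g x) (n : ℕ) (u : ℝ) :
    0 < (iterJet g n u).2.1 := by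
  rw [iterJet_snd]
  exact Finset.prod_pos fun i _ => hg _

theorem tendsto_iterJet {α : Type*} {l : Filter α} {g : α → ℝ → ℝ} {g₀ : ℝ → ℝ}
    (H : ∀ j ≤ 2, ∀ y, Tendsto (fun z : α × ℝ => iteratedDeriv j (g z.1) z.2) (l ×ˢ 𝓝 y)
      (𝓝 (iteratedDeriv j g₀ y))) (n : ℕ) (u₀ : ℝ) :
    Tendsto (fun z : α × ℝ => iterJet (g z.1) n z.2) (l ×ˢ 𝓝 u₀) (𝓝 (iterJet g₀ n u₀)) := by
  induction n with
  | zero =>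
    exact tendsto_snd.prodMk_nhds (tendsto_const_nhds)
  | succ n ih =>
    simp only [iterJet_succ, jetStep]
    have i1 := ih.fst_nhds
    have i2 := ih.snd_nhds.fst_nhds
    have i3 := ih.snd_nhds.snd_nhds
    have key : ∀ j ≤ 2, Tendsto (fun z : α × ℝ => iteratedDeriv j (g z.1) (iterJet (g z.1) n z.2).1)
        (l ×ˢ 𝓝 u₀) (𝓝 (iteratedDeriv j g₀ (iterJet g₀ n u₀).1)) := fun j hj =>
      (H j hj _).comp (tendsto_fst.prodMk i1)
    have k0 := key 0 (by norm_num)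
    simp only [iteratedDeriv_zero] at k0
    exact k0.prodMk_nhds (((key 1 (by norm_num)).mul i2).prodMk_nhds
      (((key 2 le_rfl).mul (i2.pow 2)).add ((key 1 (by norm_num)).mul i3)))

theorem tendsto_iterJet_nearLift {F : Family Λ} {φ : ℝ → ℝ → ℝ} (hΛ : ∀ j ≤ 2, (0, j) ∈ Λ)
    (hφ : IsFamilyLift Λ F.map φ) {θ₀ : ℝ} (hθ₀ : θ₀ ∈ I) (n : ℕ) (u₀ : ℝ) :
    Tendsto (fun z : (Family Λ × ℝ) × ℝ => iterJet (nearLift φ z.1.1 z.1.2) n z.2)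
      ((𝓝 F ×ˢ 𝓝[I] θ₀) ×ˢ 𝓝 u₀) (𝓝 (iterJet (φ θ₀) n u₀)) :=
  tendsto_iterJet (g := fun a : Family Λ × ℝ => nearLift φ a.1 a.2)
    (fun j hj y => tendsto_nearLift (hΛ 0 (by norm_num)) hφ (hΛ j hj) hθ₀ y) n u₀

/-- The integers coprime to `b`, as real numbers. -/
def coprimeInts (b : ℕ) : Set ℝ := (fun m : ℤ => (m : ℝ)) '' {m | IsCoprime m (b : ℤ)}

theorem isClosed_coprimeInts (b : ℕ) : IsClosed (coprimeInts b) :=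
  Int.isClosedEmbedding_coe_real.isClosedMap _ (isClosed_discrete _)

/-- `u` is a periodic point of type `(m, b)`, with `m` coprime to `b`, at which the second jet of
`g^[b]` is that of a translation. -/
def IsDegenerate (b : ℕ) (g : ℝ → ℝ) (u : ℝ) : Prop :=
  (iterJet g b u).1 - u ∈ coprimeInts b ∧ (iterJet g b u).2 = (1, 0)

theorem encard_le_two_of_hasDerivAt {s : Set ℝ} (hs : OrdConnected s) {D D' D'' : ℝ → ℝ}
    (h1 : ∀ u ∈ s, HasDerivAt D (D' u) u) (h2 : ∀ u ∈ s, HasDerivAt D' (D'' u) u)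
    (h : (∀ u ∈ s, D' u ≠ 0) ∨ ∀ u ∈ s, D'' u ≠ 0) {a : ℝ} :
    {u | u ∈ s ∧ D u = a}.encard ≤ 2 := by
  have rolle : ∀ u ∈ s, ∀ v ∈ s, u < v → D u = a → D v = a → ∃ w ∈ s, u < w ∧ w < v ∧ D' w = 0 := by
    intro u hu v hv huv hDu hDv
    have hsub : Icc u v ⊆ s := hs.out hu hv
    obtain ⟨w, hw, e⟩ := exists_hasDerivAt_eq_zero huv
      (fun y hy => (h1 y (hsub hy)).continuousAt.continuousWithinAt) (hDu.trans hDv.symm)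
      (fun y hy => h1 y (hsub (Ioo_subset_Icc_self hy)))
    exact ⟨w, hsub (Ioo_subset_Icc_self hw), hw.1, hw.2, e⟩
  have three : ∀ u v w, u ∈ s → v ∈ s → w ∈ s → D u = a → D v = a → D w = a → u < v → v < w →
      False := by
    intro u v w hu hv hw eu ev ew huv hvw
    obtain ⟨y, hy, -, hy2, ey⟩ := rolle u hu v hv huv eu ev
    obtain ⟨z, hz, hz1, -, ez⟩ := rolle v hv w hw hvw ev ew
    rcases h with h | h
    · exact h y hy ey
    · have hsub : Icc y z ⊆ s := hs.out hy hz
      obtain ⟨t, ht, e⟩ := exists_hasDerivAt_eq_zero (hy2.trans hz1)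
        (fun p hp => (h2 p (hsub hp)).continuousAt.continuousWithinAt) (ey.trans ez.symm)
        (fun p hp => h2 p (hsub (Ioo_subset_Icc_self hp)))
      exact h t (hsub (Ioo_subset_Icc_self ht)) e
  by_contra! hlt
  have hle : (3 : ℕ∞) ≤ {u | u ∈ s ∧ D u = a}.encard := by
    rw [show (3 : ℕ∞) = 2 + 1 by norm_num]
    exact Order.add_one_le_of_lt hlt
  obtain ⟨t, ht, ht3⟩ := exists_subset_encard_eq hle
  obtain ⟨u, v, w, huv, huw, hvw, rfl⟩ := encard_eq_three.1 ht3
  obtain ⟨hu, eu⟩ := ht (show u ∈ _ by simp)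
  obtain ⟨hv, ev⟩ := ht (show v ∈ _ by simp)
  obtain ⟨hw, ew⟩ := ht (show w ∈ _ by simp)
  rcases lt_or_gt_of_ne huv with a1 | a1 <;> rcases lt_or_gt_of_ne huw with a2 | a2 <;>
    rcases lt_or_gt_of_ne hvw with a3 | a3
  · exact three u v w hu hv hw eu ev ew a1 a3
  · exact three u w v hu hw hv eu ew ev a2 a3
  · exact lt_asymm (a1.trans a3) a2
  · exact three w u v hw hu hv ew eu ev a2 a1
  · exact three v u w hv hu hw ev eu ew a1 a2
  · exact lt_asymm (a1.trans a2) a3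
  · exact three v w u hv hw hu ev ew eu a3 a2
  · exact three w v u hw hv hu ew ev eu a3 a1

/-- Without degenerate periodic points the number of periodic points is locally bounded. -/
theorem exists_eventually_encard_le {F : Family Λ} {φ : ℝ → ℝ → ℝ} (hΛ : ∀ j ≤ 2, (0, j) ∈ Λ)
    (hφ : IsFamilyLift Λ F.map φ) {b : ℕ}
    (hb : ∀ θ ∈ I, ∀ u ∈ Icc (0 : ℝ) 1, ¬ IsDegenerate b (φ θ) u) :
    ∃ M : ℕ, ∀ᶠ G in 𝓝 F, ∀ θ ∈ I, {u : ℝ | (θ, u) ∈ I ×ˢ Icc (0 : ℝ) 1 ∧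
      (nearLift φ G θ)^[b] u - u ∈ coprimeInts b}.encard ≤ M := by
  refine isCompact_box.induction_on (p := fun s : Set (ℝ × ℝ) => ∃ M : ℕ, ∀ᶠ G in 𝓝 F, ∀ θ ∈ I,
    {u : ℝ | (θ, u) ∈ s ∧ (nearLift φ G θ)^[b] u - u ∈ coprimeInts b}.encard ≤ M) ?_ ?_ ?_ ?_
  · exact ⟨0, by simp⟩
  · rintro s t hst ⟨M, hM⟩
    refine ⟨M, hM.mono fun G hG θ hθ => le_trans (encard_le_encard ?_) (hG θ hθ)⟩
    exact fun u hu => ⟨hst hu.1, hu.2⟩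
  · rintro s t ⟨M, hM⟩ ⟨N, hN⟩
    refine ⟨M + N, ?_⟩
    filter_upwards [hM, hN] with G h1 h2 θ hθ
    calc _ ≤ ({u : ℝ | (θ, u) ∈ s ∧ (nearLift φ G θ)^[b] u - u ∈ coprimeInts b} ∪
          {u : ℝ | (θ, u) ∈ t ∧ (nearLift φ G θ)^[b] u - u ∈ coprimeInts b}).encard :=
          encard_le_encard fun u hu => by
            rcases hu with ⟨h | h, h'⟩
            exacts [Or.inl ⟨h, h'⟩, Or.inr ⟨h, h'⟩]
      _ ≤ _ := encard_union_le _ _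
      _ ≤ _ := by push_cast; exact add_le_add (h1 θ hθ) (h2 θ hθ)
  · rintro ⟨θ₀, u₀⟩ ⟨hθ₀, hu₀⟩
    have hθ₀ : θ₀ ∈ I := hθ₀
    have ht := tendsto_iterJet_nearLift hΛ hφ hθ₀ b u₀
    have htD : Tendsto (fun z : (Family Λ × ℝ) × ℝ =>
        (iterJet (nearLift φ z.1.1 z.1.2) b z.2).1 - z.2) ((𝓝 F ×ˢ 𝓝[I] θ₀) ×ˢ 𝓝 u₀)
        (𝓝 ((iterJet (φ θ₀) b u₀).1 - u₀)) := ht.fst_nhds.sub tendsto_snd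
    have prod : ∀ {p : (Family Λ × ℝ) × ℝ → Prop}, (∀ᶠ z in (𝓝 F ×ˢ 𝓝[I] θ₀) ×ˢ 𝓝 u₀, p z) →
        ∃ δ > 0, ∃ t ∈ 𝓝[I] θ₀, ∀ᶠ G in 𝓝 F, ∀ θ ∈ t, ∀ u ∈ Metric.ball u₀ δ, p ((G, θ), u) := by
      intro p hp
      obtain ⟨s, hs, v, hv, h⟩ := mem_prod_iff.1 hp
      obtain ⟨w, hw, t, ht, h'⟩ := mem_prod_iff.1 hs
      obtain ⟨δ, hδ, hball⟩ := Metric.mem_nhds_iff.1 hv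
      refine ⟨δ, hδ, t, ht, ?_⟩
      filter_upwards [hw] with G hG θ hθ u hu
      exact h ⟨h' ⟨hG, hθ⟩, hball hu⟩
    have nh : ∀ {δ : ℝ}, 0 < δ → ∀ t ∈ 𝓝[I] θ₀,
        t ×ˢ Metric.ball u₀ δ ∈ 𝓝[I ×ˢ Icc (0 : ℝ) 1] (θ₀, u₀) := fun hδ t ht => by
      rw [nhdsWithin_prod_eq]
      exact prod_mem_prod ht (nhdsWithin_le_nhds (Metric.ball_mem_nhds _ hδ))
    by_cases hmem : (iterJet (φ θ₀) b u₀).1 - u₀ ∈ coprimeInts b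
    · obtain ⟨m, hmc, hm⟩ := hmem
      have hcase : ∃ N : Set (ℝ × ℝ × ℝ), N ∈ 𝓝 (iterJet (φ θ₀) b u₀) ∧
          ((∀ z ∈ N, z.2.1 ≠ 1) ∨ ∀ z ∈ N, z.2.2 ≠ 0) := by
        have := hb θ₀ hθ₀ u₀ hu₀
        simp only [IsDegenerate, Prod.ext_iff, not_and_or] at this
        rcases this with h | h | h
        · exact absurd ⟨m, hmc, hm⟩ h
        · exact ⟨{z | z.2.1 ≠ 1}, (isOpen_ne.preimage (by fun_prop)).mem_nhds h, Or.inl fun z hz => hz⟩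
        · exact ⟨{z | z.2.2 ≠ 0}, (isOpen_ne.preimage (by fun_prop)).mem_nhds h, Or.inr fun z hz => hz⟩
      obtain ⟨N, hN, hN'⟩ := hcase
      obtain ⟨δ, hδ, t, ht', H⟩ := prod ((ht.eventually hN).and
        (htD.eventually (Metric.ball_mem_nhds _ (ε := 1) one_pos)))
      refine ⟨t ×ˢ Metric.ball u₀ δ, nh hδ t ht', 2, ?_⟩
      filter_upwards [H] with G hG θ hθ
      by_cases hθt : θ ∈ t
      swap
      · refine le_trans (le_of_eq ?_) zero_le
        rw [encard_eq_zero, eq_empty_iff_forall_notMem]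
        exact fun u hu => hθt hu.1.1
      set g := nearLift φ G θ with hg
      have hg2 : ContDiff ℝ 2 g :=
        ((isFamilyLift_nearLift φ G).smooth 0 2 (hΛ 2 le_rfl)).contDiff_phase θ hθ
      refine (encard_le_encard ?_).trans (encard_le_two_of_hasDerivAt
        (s := Metric.ball u₀ δ) (by rw [Real.ball_eq_Ioo]; exact ordConnected_Ioo)
        (D := fun u => (iterJet g b u).1 - u) (D' := fun u => (iterJet g b u).2.1 - 1)
        (D'' := fun u => (iterJet g b u).2.2)
        (fun u _ => (hasDerivAt_iterJet hg2 b u).1.sub (hasDerivAt_id u))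
        (fun u _ => (hasDerivAt_iterJet hg2 b u).2.sub_const 1)
        (hN'.imp (fun h u hu => sub_ne_zero.2 (h _ (hG θ hθt u hu).1))
          (fun h u hu => h _ (hG θ hθt u hu).1)) (a := m))
      rintro u ⟨hu, m', -, hm'⟩
      refine ⟨hu.2, ?_⟩
      have h1 := (hG θ hθt u hu.2).2
      simp only at h1 hm' hm
      rw [iterJet_fst, ← hg, ← hm', ← hm, Real.dist_eq] at h1
      have h2 : |m' - m| < 1 := by exact_mod_cast h1
      have h3 : m' = m := by rw [Int.abs_lt_one_iff] at h2; omega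
      rw [iterJet_fst, ← hm', h3]
    · obtain ⟨δ, hδ, t, ht, H⟩ := prod (htD.eventually
        ((isClosed_coprimeInts b).isOpen_compl.mem_nhds hmem))
      refine ⟨t ×ˢ Metric.ball u₀ δ, nh hδ t ht, 0, ?_⟩
      filter_upwards [H] with G hG θ hθ
      rw [Nat.cast_zero, nonpos_iff_eq_zero, encard_eq_zero, eq_empty_iff_forall_notMem]
      rintro u ⟨hu, hu'⟩
      refine hG θ hu.1 u hu.2 ?_
      rwa [iterJet_fst]

/-! ### Bump functions on the circle -/

/-- Half the squared chordal distance between the projections of `x` and `y` to the circle. -/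
def chord (x y : ℝ) : ℝ := 1 - Real.cos (2 * Real.pi * (x - y))

theorem chord_nonneg (x y : ℝ) : 0 ≤ chord x y := sub_nonneg.2 (Real.cos_le_one _)

theorem chord_comm (x y : ℝ) : chord x y = chord y x := by
  unfold chord
  rw [← Real.cos_neg]
  ring_nf

theorem chord_eq_zero_iff {x y : ℝ} : chord x y = 0 ↔ (x : S1) = y := by
  rw [chord, sub_eq_zero, eq_comm, Real.cos_eq_one_iff, coe_eq_coe_iff]
  refine exists_congr fun n => ⟨fun h => ?_, fun h => by rw [h]; ring⟩
  have : 2 * Real.pi * (n - (x - y)) = 0 := by linarith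
  have h2 := (mul_eq_zero.1 this).resolve_left (by positivity)
  linarith

theorem chord_pos_iff {x y : ℝ} : 0 < chord x y ↔ (x : S1) ≠ y := by
  rw [(chord_nonneg x y).lt_iff_ne', ne_eq, chord_eq_zero_iff]

theorem chord_add_one (x y : ℝ) : chord (x + 1) y = chord x y := by
  unfold chord
  rw [show 2 * Real.pi * (x + 1 - y) = 2 * Real.pi * (x - y) + 2 * Real.pi by ring,
    Real.cos_add_two_pi]

theorem chord_le (x y z : ℝ) : chord x z ≤ 2 * (chord x y + chord y z) := by
  unfold chord
  rw [show 2 * Real.pi * (x - z) = 2 * Real.pi * (x - y) + 2 * Real.pi * (y - z) by ring,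
    Real.cos_add]
  set a := 2 * Real.pi * (x - y)
  set b := 2 * Real.pi * (y - z)
  nlinarith [sq_nonneg (Real.cos a + Real.cos b - 2), sq_nonneg (Real.sin a - Real.sin b),
    Real.sin_sq_add_cos_sq a, Real.sin_sq_add_cos_sq b]

theorem continuous_chord : Continuous fun p : ℝ × ℝ => chord p.1 p.2 := by
  unfold chord; fun_prop

/-- A smooth periodic function equal to one where `chord x a ≤ e` and vanishing where
`2 * e ≤ chord x a`. -/
def bump (a e x : ℝ) : ℝ := Real.smoothTransition ((2 * e - chord x a) / e)

theorem contDiff_bump (a e : ℝ) (n : ℕ) : ContDiff ℝ n (bump a e) := by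
  have h : ContDiff ℝ n fun x => (2 * e - chord x a) / e := by
    unfold chord
    refine ContDiff.div_const (contDiff_const.sub (contDiff_const.sub ?_)) _
    exact Real.contDiff_cos.comp (by fun_prop)
  exact (Real.smoothTransition.contDiff (n := n)).comp h

theorem bump_add_one (a e x : ℝ) : bump a e (x + 1) = bump a e x := by
  rw [bump, bump, chord_add_one]

theorem bump_eventuallyEq_one {a e x : ℝ} (he : 0 < e) (hx : chord x a < e) :
    bump a e =ᶠ[𝓝 x] fun _ => 1 := by
  have hc : Continuous fun y => chord y a := by unfold chord; fun_prop
  filter_upwards [hc.continuousAt.eventually (gt_mem_nhds hx)] with y hy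
  refine Real.smoothTransition.one_of_one_le ?_
  rw [le_div_iff₀ he]
  linarith

theorem bump_eventuallyEq_zero {a e x : ℝ} (he : 0 < e) (hx : 2 * e < chord x a) :
    bump a e =ᶠ[𝓝 x] fun _ => 0 := by
  have hc : Continuous fun y => chord y a := by unfold chord; fun_prop
  filter_upwards [hc.continuousAt.eventually (lt_mem_nhds hx)] with y hy
  refine Real.smoothTransition.zero_of_nonpos ?_
  exact div_nonpos_of_nonpos_of_nonneg (by linarith) he.le

/-- The functions `1`, `cos (2 π x)`, `sin (2 π x)`. -/
def trig (l : Fin 3) (x : ℝ) : ℝ := ![1, Real.cos (2 * Real.pi * x), Real.sin (2 * Real.pi * x)] l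

theorem contDiff_trig (l : Fin 3) (n : ℕ) : ContDiff ℝ n (trig l) := by
  have h : ContDiff ℝ n fun x : ℝ => 2 * Real.pi * x := by fun_prop
  fin_cases l
  · exact contDiff_const
  · exact Real.contDiff_cos.comp h
  · exact Real.contDiff_sin.comp h

theorem trig_add_one (l : Fin 3) (x : ℝ) : trig l (x + 1) = trig l x := by
  have : 2 * Real.pi * (x + 1) = 2 * Real.pi * x + 2 * Real.pi := by ring
  fin_cases l <;> simp [trig, this]

theorem hasDerivAt_two_pi_mul (x : ℝ) : HasDerivAt (fun x : ℝ => 2 * Real.pi * x) (2 * Real.pi) x := by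
  simpa using (hasDerivAt_id x).const_mul (2 * Real.pi)

theorem deriv_trig_one : deriv (trig 1) = fun x => -(2 * Real.pi) * Real.sin (2 * Real.pi * x) := by
  ext x
  have := ((hasDerivAt_two_pi_mul x).cos).deriv
  exact this.trans (by ring)

theorem deriv_trig_two : deriv (trig 2) = fun x => (2 * Real.pi) * Real.cos (2 * Real.pi * x) := by
  ext x
  have := ((hasDerivAt_two_pi_mul x).sin).deriv
  exact this.trans (by ring)

theorem iteratedDeriv_two_trig_one (x : ℝ) :
    iteratedDeriv 2 (trig 1) x = -(2 * Real.pi) ^ 2 * Real.cos (2 * Real.pi * x) := by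
  rw [iteratedDeriv_succ, iteratedDeriv_one, deriv_trig_one]
  exact (((hasDerivAt_two_pi_mul x).sin).const_mul _).deriv.trans (by ring)

theorem iteratedDeriv_two_trig_two (x : ℝ) :
    iteratedDeriv 2 (trig 2) x = -(2 * Real.pi) ^ 2 * Real.sin (2 * Real.pi * x) := by
  rw [iteratedDeriv_succ, iteratedDeriv_one, deriv_trig_two]
  exact (((hasDerivAt_two_pi_mul x).cos).const_mul _).deriv.trans (by ring)

/-- The localized trigonometric functions. -/
def bumpTrig (a e : ℝ) (l : Fin 3) (x : ℝ) : ℝ := bump a e x * trig l x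

theorem contDiff_bumpTrig (a e : ℝ) (l : Fin 3) (n : ℕ) : ContDiff ℝ n (bumpTrig a e l) :=
  (contDiff_bump a e n).mul (contDiff_trig l n)

theorem bumpTrig_add_one (a e : ℝ) (l : Fin 3) (x : ℝ) :
    bumpTrig a e l (x + 1) = bumpTrig a e l x := by
  rw [bumpTrig, bump_add_one, trig_add_one, bumpTrig]

theorem iteratedDeriv_bumpTrig_of_lt {a e x : ℝ} (he : 0 < e) (hx : chord x a < e) (l : Fin 3)
    (j : ℕ) : iteratedDeriv j (bumpTrig a e l) x = iteratedDeriv j (trig l) x := by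
  refine Filter.EventuallyEq.iteratedDeriv_eq j ?_
  filter_upwards [bump_eventuallyEq_one he hx] with y hy
  rw [bumpTrig, hy, one_mul]

theorem iteratedDeriv_bumpTrig_of_gt {a e x : ℝ} (he : 0 < e) (hx : 2 * e < chord x a) (l : Fin 3)
    (j : ℕ) : iteratedDeriv j (bumpTrig a e l) x = 0 := by
  have : bumpTrig a e l =ᶠ[𝓝 x] fun _ => 0 := by
    filter_upwards [bump_eventuallyEq_zero he hx] with y hy
    rw [bumpTrig, hy, zero_mul]
  rw [this.iteratedDeriv_eq j]
  simp

/-! ### Locally Lipschitz maps and dimension -/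

section LocallyLipschitz

variable {X Y Z : Type*} [PseudoEMetricSpace X] [PseudoEMetricSpace Y] [PseudoEMetricSpace Z]

theorem locallyLipschitzOn_prodMk {s : Set X} {f : X → Y} {g : X → Z}
    (hf : LocallyLipschitzOn s f) (hg : LocallyLipschitzOn s g) :
    LocallyLipschitzOn s fun x => (f x, g x) := by
  intro x hx
  obtain ⟨K, t, ht, h⟩ := hf hx
  obtain ⟨K', t', ht', h'⟩ := hg hx
  exact ⟨_, t ∩ t', inter_mem ht ht', (h.mono inter_subset_left).prodMk (h'.mono inter_subset_right)⟩

theorem locallyLipschitzOn_comp {s : Set X} {t : Set Y} {f : X → Y} {g : Y → Z}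
    (hg : LocallyLipschitzOn t g) (hf : LocallyLipschitzOn s f) (hst : MapsTo f s t) :
    LocallyLipschitzOn s fun x => g (f x) := by
  intro x hx
  obtain ⟨K, u, hu, h⟩ := hf hx
  obtain ⟨K', u', hu', h'⟩ := hg (hst hx)
  have hcont : Tendsto f (𝓝[s] x) (𝓝[t] (f x)) :=
    tendsto_nhdsWithin_iff.2 ⟨hf.continuousOn x hx, eventually_mem_nhdsWithin.mono hst⟩
  refine ⟨K' * K, u ∩ f ⁻¹' u', inter_mem hu (hcont hu'), ?_⟩
  exact h'.comp (h.mono inter_subset_left) fun y hy => hy.2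

end LocallyLipschitz

theorem locallyLipschitzOn_of_contDiffAt {E F : Type*} [NormedAddCommGroup E] [NormedSpace ℝ E]
    [NormedAddCommGroup F] [NormedSpace ℝ F] {s : Set E} {f : E → F}
    (h : ∀ x ∈ s, ContDiffAt ℝ 1 f x) : LocallyLipschitzOn s f := fun x hx => by
  obtain ⟨K, t, ht, h'⟩ := (h x hx).exists_lipschitzOnWith
  exact ⟨K, t, nhdsWithin_le_nhds ht, h'⟩

theorem StripLipschitz.locallyLipschitzOn {m : ℝ → ℝ → ℝ} (h : StripLipschitz m) :
    LocallyLipschitzOn (I ×ˢ univ) fun p : ℝ × ℝ => m p.1 p.2 := by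
  obtain ⟨K, hK, H⟩ := h
  intro p _
  refine ⟨(K * 2).toNNReal, I ×ˢ univ, self_mem_nhdsWithin,
    LipschitzOnWith.of_dist_le_mul fun x hx y hy => ?_⟩
  rw [Real.coe_toNNReal _ (by positivity), Real.dist_eq, mul_assoc]
  refine (H x.1 hx.1 y.1 hy.1 x.2 y.2).trans (mul_le_mul_of_nonneg_left ?_ hK)
  have h1 : |x.1 - y.1| ≤ dist x y := le_max_left (dist x.1 y.1) (dist x.2 y.2)
  have h2 : |x.2 - y.2| ≤ dist x y := le_max_right (dist x.1 y.1) (dist x.2 y.2)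
  linarith

theorem locallyLipschitzOn_iterJet {χ : ℝ → ℝ → ℝ}
    (hχ : ∀ j ≤ 2, StripLipschitz fun θ x => iteratedDeriv j (χ θ) x) (n : ℕ) :
    LocallyLipschitzOn (I ×ˢ univ) fun p : ℝ × ℝ => iterJet (χ p.1) n p.2 := by
  induction n with
  | zero =>
    exact locallyLipschitzOn_of_contDiffAt (f := fun p : ℝ × ℝ => (p.2, (1 : ℝ), (0 : ℝ)))
      fun x _ => by fun_prop
  | succ n ih =>
    have hy : LocallyLipschitzOn (I ×ˢ univ) fun p : ℝ × ℝ => (p.1, (iterJet (χ p.1) n p.2).1) :=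
      locallyLipschitzOn_prodMk (locallyLipschitzOn_of_contDiffAt fun x _ => by fun_prop)
        (locallyLipschitzOn_comp (t := univ) (g := Prod.fst)
          (locallyLipschitzOn_of_contDiffAt fun x _ => by fun_prop) ih (mapsTo_univ _ _))
    have hj : ∀ j ≤ 2, LocallyLipschitzOn (I ×ˢ univ)
        fun p : ℝ × ℝ => iteratedDeriv j (χ p.1) (iterJet (χ p.1) n p.2).1 := fun j hj =>
      locallyLipschitzOn_comp (hχ j hj).locallyLipschitzOn hy fun p hp => ⟨hp.1, mem_univ _⟩
    have hall := locallyLipschitzOn_prodMk ih (locallyLipschitzOn_prodMk (hj 0 (by norm_num))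
      (locallyLipschitzOn_prodMk (hj 1 (by norm_num)) (hj 2 le_rfl)))
    have := locallyLipschitzOn_comp (t := univ)
      (g := fun z : (ℝ × ℝ × ℝ) × ℝ × ℝ × ℝ => ((z.2.1, z.2.2.1 * z.1.2.1,
        z.2.2.2 * z.1.2.1 ^ 2 + z.2.2.1 * z.1.2.2) : ℝ × ℝ × ℝ))
      (locallyLipschitzOn_of_contDiffAt fun x _ => by fun_prop) hall (mapsTo_univ _ _)
    simpa only [iterJet_succ, jetStep, iteratedDeriv_zero] using this

/-- The coefficients of the trigonometric polynomial whose addition makes the second jet at `u` of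
the composition of `g` with a map of second jet `(y, v, w)` that of the translation by `m`. -/
def degenCoeff (m u : ℝ) (z p : ℝ × ℝ × ℝ) : Fin 3 → ℝ :=
  ![u + m - p.1 + (-p.2.2 - z.2.2 / z.2.1 ^ 3) / (2 * Real.pi) ^ 2,
    -Real.sin (2 * Real.pi * z.1) * (1 / z.2.1 - p.2.1) / (2 * Real.pi) -
      Real.cos (2 * Real.pi * z.1) * (-p.2.2 - z.2.2 / z.2.1 ^ 3) / (2 * Real.pi) ^ 2,
    Real.cos (2 * Real.pi * z.1) * (1 / z.2.1 - p.2.1) / (2 * Real.pi) -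
      Real.sin (2 * Real.pi * z.1) * (-p.2.2 - z.2.2 / z.2.1 ^ 3) / (2 * Real.pi) ^ 2]

theorem contDiffAt_degenCoeff (m : ℝ) {q : ℝ × (ℝ × ℝ × ℝ) × (ℝ × ℝ × ℝ)} (hq : q.2.1.2.1 ≠ 0) :
    ContDiffAt ℝ 1 (fun q : ℝ × (ℝ × ℝ × ℝ) × (ℝ × ℝ × ℝ) => degenCoeff m q.1 q.2.1 q.2.2) q := by
  have hpi : (2 * Real.pi) ≠ 0 := by positivity
  have h3 : q.2.1.2.1 ^ 3 ≠ 0 := pow_ne_zero _ hq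
  rw [contDiffAt_pi]
  intro i
  fin_cases i <;> simp [degenCoeff] <;> fun_prop (disch := assumption)

/-- The parameters of degenerate perturbations. -/
def degenSet (χ : ℝ → ℝ → ℝ) (n : ℕ) : Set (Fin 3 → ℝ) :=
  ⋃ m : ℤ, (fun p : ℝ × ℝ => degenCoeff m p.2 (iterJet (χ p.1) n p.2)
    (iteratedDeriv 0 (χ p.1) (iterJet (χ p.1) n p.2).1,
      iteratedDeriv 1 (χ p.1) (iterJet (χ p.1) n p.2).1,
      iteratedDeriv 2 (χ p.1) (iterJet (χ p.1) n p.2).1)) '' (I ×ˢ univ)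

theorem dense_compl_degenSet {χ : ℝ → ℝ → ℝ}
    (hχ : ∀ j ≤ 2, StripLipschitz fun θ x => iteratedDeriv j (χ θ) x)
    (hpos : ∀ θ ∈ I, ∀ x, 0 < deriv (χ θ) x) (n : ℕ) : Dense (degenSet χ n)ᶜ := by
  refine dense_compl_of_dimH_lt_finrank ?_
  have hle : dimH (degenSet χ n) ≤ 2 := by
    rw [degenSet, dimH_iUnion]
    refine iSup_le fun m => ?_
    have ih := locallyLipschitzOn_iterJet hχ n
    have hy : LocallyLipschitzOn (I ×ˢ univ) fun p : ℝ × ℝ => (p.1, (iterJet (χ p.1) n p.2).1) :=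
      locallyLipschitzOn_prodMk (locallyLipschitzOn_of_contDiffAt fun x _ => by fun_prop)
        (locallyLipschitzOn_comp (t := univ) (g := Prod.fst)
          (locallyLipschitzOn_of_contDiffAt fun x _ => by fun_prop) ih (mapsTo_univ _ _))
    have hj : ∀ j ≤ 2, LocallyLipschitzOn (I ×ˢ univ)
        fun p : ℝ × ℝ => iteratedDeriv j (χ p.1) (iterJet (χ p.1) n p.2).1 := fun j hj =>
      locallyLipschitzOn_comp (hχ j hj).locallyLipschitzOn hy fun p hp => ⟨hp.1, mem_univ _⟩
    have hall := locallyLipschitzOn_prodMk (f := fun p : ℝ × ℝ => p.2)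
      (locallyLipschitzOn_of_contDiffAt fun x _ => by fun_prop)
      (locallyLipschitzOn_prodMk ih (locallyLipschitzOn_prodMk (hj 0 (by norm_num))
      (locallyLipschitzOn_prodMk (hj 1 (by norm_num)) (hj 2 le_rfl))))
    have := locallyLipschitzOn_comp (t := {q : ℝ × (ℝ × ℝ × ℝ) × (ℝ × ℝ × ℝ) | q.2.1.2.1 ≠ 0})
      (locallyLipschitzOn_of_contDiffAt fun q hq => contDiffAt_degenCoeff m hq) hall
      (fun p hp => (iterJet_snd_pos (hpos p.1 hp.1) n p.2).ne')
    refine (dimH_image_le_of_locally_lipschitzOn this).trans ((dimH_mono (subset_univ _)).trans ?_)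
    rw [Real.dimH_univ_eq_finrank]
    simp [one_add_one_eq_two]
  refine hle.trans_lt ?_
  simp
  norm_num

/-! ### Families without degenerate periodic points -/

/-- If `u` is periodic of type `(m, b + 1)` with `m` coprime to `b + 1`, then its first `b` iterates
are `d`-separated from the last point of the orbit. -/
def IsSeparated (b : ℕ) (d : ℝ) (g : ℝ → ℝ) (u : ℝ) : Prop :=
  (iterJet g (b + 1) u).1 - u ∈ coprimeInts (b + 1) →
    ∀ n < b, d ≤ chord (iterJet g n u).1 (iterJet g b u).1

theorem mem_degenSet {χ : ℝ → ℝ → ℝ} (hχ : IsLineFamily Λ χ) (hΛ : ∀ j ≤ 2, (0, j) ∈ Λ)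
    {b : ℕ} {a e : ℝ} (he : 0 < e) {s : Fin 3 → ℝ} {θ u : ℝ} (hθ : θ ∈ I)
    (hsep : IsSeparated b (6 * e) (perturb χ (bumpTrig a e) s θ) u)
    (hdeg : IsDegenerate (b + 1) (perturb χ (bumpTrig a e) s θ) u)
    (ha : chord (iterJet (perturb χ (bumpTrig a e) s θ) b u).1 a ≤ e / 2) : s ∈ degenSet χ b := by
  have hP : ∀ (i : Fin 3) (n : ℕ), ContDiff ℝ n (bumpTrig a e i) := contDiff_bumpTrig a e
  set g := perturb χ (bumpTrig a e) s θ with hg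
  have hsep := hsep hdeg.1
  have hder : ∀ j ≤ 2, ∀ x, iteratedDeriv j g x = iteratedDeriv j (χ θ) x +
      ∑ i, s i * iteratedDeriv j (bumpTrig a e i) x := fun j hj x =>
    iteratedDeriv_perturb hχ hP s (hΛ j hj) hθ x
  have hoff : ∀ x, 2 * e < chord x a → ∀ z : ℝ × ℝ × ℝ, z.1 = x → jetStep g z = jetStep (χ θ) z := by
    rintro x hx z rfl
    have h : ∀ j ≤ 2, iteratedDeriv j g z.1 = iteratedDeriv j (χ θ) z.1 := fun j hj => by
      rw [hder j hj]
      simp [iteratedDeriv_bumpTrig_of_gt he hx]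
    have h0 := h 0 (by norm_num)
    simp only [iteratedDeriv_zero] at h0
    simp only [jetStep, h 1 (by norm_num), h 2 le_rfl, h0]
  have hiter : ∀ n ≤ b, iterJet g n u = iterJet (χ θ) n u := by
    intro n
    induction n with
    | zero => intro; rfl
    | succ n ih =>
      intro hn
      rw [iterJet_succ, iterJet_succ, ← ih (by omega)]
      refine hoff _ ?_ _ rfl
      by_contra! hle
      have h1 := hsep n (by omega)
      have h2 := chord_le (iterJet g n u).1 a (iterJet g b u).1
      rw [chord_comm a] at h2
      linarith
  rw [hiter b le_rfl] at ha
  obtain ⟨⟨m, -, hm⟩, hd2⟩ := hdeg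
  rw [iterJet_succ, hiter b le_rfl] at hm hd2
  set z := iterJet (χ θ) b u with hz
  have hv : z.2.1 ≠ 0 := (iterJet_snd_pos (hχ.deriv_pos ⟨θ, hθ⟩) b u).ne'
  have hlt : chord z.1 a < e := by linarith
  simp only [jetStep, Prod.ext_iff] at hm hd2
  obtain ⟨hd1, hd2⟩ := hd2
  have e0 := hder 0 (by norm_num) z.1
  have e1 := hder 1 (by norm_num) z.1
  have e2 := hder 2 le_rfl z.1
  simp only [iteratedDeriv_bumpTrig_of_lt he hlt, Fin.sum_univ_three] at e0 e1 e2
  have t0 : trig 0 = fun _ => 1 := rfl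
  rw [iteratedDeriv_two_trig_one, iteratedDeriv_two_trig_two, t0] at e2
  simp only [iteratedDeriv_one, deriv_trig_one, deriv_trig_two, t0] at e1
  simp only [iteratedDeriv_zero, t0] at e0
  simp only [deriv_const', iteratedDeriv_const, OfNat.ofNat_ne_zero, if_false] at e1 e2
  rw [show trig 1 z.1 = Real.cos (2 * Real.pi * z.1) from rfl,
    show trig 2 z.1 = Real.sin (2 * Real.pi * z.1) from rfl] at e0
  refine mem_iUnion.2 ⟨m, (θ, u), ⟨hθ, mem_univ _⟩, ?_⟩
  simp only [← hz]
  have hpi : (2 * Real.pi) ≠ 0 := by positivity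
  have hsc := Real.sin_sq_add_cos_sq (2 * Real.pi * z.1)
  have k1 : 1 / z.2.1 - iteratedDeriv 1 (χ θ) z.1 = 2 * Real.pi *
      (-s 1 * Real.sin (2 * Real.pi * z.1) + s 2 * Real.cos (2 * Real.pi * z.1)) := by
    have : iteratedDeriv 1 g z.1 = 1 / z.2.1 := by rw [eq_div_iff hv]; exact hd1
    rw [← this, iteratedDeriv_one, iteratedDeriv_one, e1]
    ring
  have k2 : -iteratedDeriv 2 (χ θ) z.1 - z.2.2 / z.2.1 ^ 3 = (2 * Real.pi) ^ 2 *
      (-s 1 * Real.cos (2 * Real.pi * z.1) - s 2 * Real.sin (2 * Real.pi * z.1)) := by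
    have h1 : iteratedDeriv 1 g z.1 = 1 / z.2.1 := by rw [eq_div_iff hv]; exact hd1
    have : iteratedDeriv 2 g z.1 = - z.2.2 / z.2.1 ^ 3 := by
      rw [h1] at hd2
      rw [eq_div_iff (pow_ne_zero _ hv)]
      field_simp at hd2
      linarith
    have e2' := e2
    rw [this] at e2'
    have : z.2.2 / z.2.1 ^ 3 = -(-z.2.2 / z.2.1 ^ 3) := by ring
    rw [this, e2']
    ring
  have k0 : u + m - iteratedDeriv 0 (χ θ) z.1 = s 0 + s 1 * Real.cos (2 * Real.pi * z.1) +
      s 2 * Real.sin (2 * Real.pi * z.1) := by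
    rw [iteratedDeriv_zero]
    linarith
  ext i
  fin_cases i
  · simp only [degenCoeff, k2, k0]
    simp
  · simp only [degenCoeff, k2, k1]
    simp
    field_simp
    linear_combination (s 1) * hsc
  · simp only [degenCoeff, k2, k1]
    simp
    field_simp
    linear_combination (s 2) * hsc

theorem eventually_forall_box {α : Type*} {l : Filter α} {p : (α × ℝ) × ℝ → Prop}
    (h : ∀ θ₀ ∈ I, ∀ u₀ ∈ Icc (0 : ℝ) 1, ∀ᶠ z in (l ×ˢ 𝓝[I] θ₀) ×ˢ 𝓝 u₀, p z) :
    ∀ᶠ a in l, ∀ θ ∈ I, ∀ u ∈ Icc (0 : ℝ) 1, p ((a, θ), u) := by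
  have : ∀ᶠ a in l, ∀ q ∈ I ×ˢ Icc (0 : ℝ) 1, p ((a, q.1), q.2) := by
    refine isCompact_box.induction_on (p := fun s : Set (ℝ × ℝ) =>
      ∀ᶠ a in l, ∀ q ∈ s, p ((a, q.1), q.2)) (by simp) ?_ ?_ ?_
    · exact fun s t hst ht => ht.mono fun a ha q hq => ha q (hst hq)
    · intro s t hs ht
      filter_upwards [hs, ht] with a h1 h2 q hq
      exact hq.elim (h1 q) (h2 q)
    · rintro ⟨θ₀, u₀⟩ ⟨hθ₀, hu₀⟩
      obtain ⟨s, hs, v, hv, h⟩ := mem_prod_iff.1 (h θ₀ hθ₀ u₀ hu₀)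
      obtain ⟨w, hw, t, ht, h'⟩ := mem_prod_iff.1 hs
      refine ⟨t ×ˢ v, ?_, ?_⟩
      · rw [nhdsWithin_prod_eq]
        exact prod_mem_prod ht (nhdsWithin_le_nhds hv)
      · filter_upwards [hw] with a ha q hq
        exact h ⟨h' ⟨ha, hq.1⟩, hq.2⟩
  exact this.mono fun a ha θ hθ u hu => ha (θ, u) ⟨hθ, hu⟩

theorem exists_eventually_isSeparated {F : Family Λ} {φ : ℝ → ℝ → ℝ} (hΛ : ∀ j ≤ 2, (0, j) ∈ Λ)
    (hφ : IsFamilyLift Λ F.map φ) (b : ℕ) :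
    ∃ d > 0, ∀ᶠ G in 𝓝 F, ∀ θ ∈ I, ∀ u ∈ Icc (0 : ℝ) 1, IsSeparated b d (nearLift φ G θ) u := by
  have : ∃ d > 0, ∀ᶠ G in 𝓝 F, ∀ q ∈ I ×ˢ Icc (0 : ℝ) 1,
      IsSeparated b d (nearLift φ G q.1) q.2 := by
    refine isCompact_box.induction_on (p := fun s : Set (ℝ × ℝ) => ∃ d > 0, ∀ᶠ G in 𝓝 F,
      ∀ q ∈ s, IsSeparated b d (nearLift φ G q.1) q.2) ⟨1, one_pos, by simp⟩ ?_ ?_ ?_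
    · rintro s t hst ⟨d, hd, ht⟩
      exact ⟨d, hd, ht.mono fun a ha q hq => ha q (hst hq)⟩
    · rintro s t ⟨d, hd, hs⟩ ⟨d', hd', ht⟩
      refine ⟨min d d', lt_min hd hd', ?_⟩
      filter_upwards [hs, ht] with a h1 h2 q hq
      rcases hq with hq | hq
      · exact fun hc n hn => (min_le_left _ _).trans (h1 q hq hc n hn)
      · exact fun hc n hn => (min_le_right _ _).trans (h2 q hq hc n hn)
    · rintro ⟨θ₀, u₀⟩ ⟨hθ₀, -⟩
      have hθ₀ : θ₀ ∈ I := hθ₀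
      have ht := fun n => tendsto_iterJet_nearLift hΛ hφ hθ₀ n u₀
      have key : ∃ d > 0, ∀ᶠ z : (Family Λ × ℝ) × ℝ in (𝓝 F ×ˢ 𝓝[I] θ₀) ×ˢ 𝓝 u₀,
          IsSeparated b d (nearLift φ z.1.1 z.1.2) z.2 := by
        by_cases hmem : (iterJet (φ θ₀) (b + 1) u₀).1 - u₀ ∈ coprimeInts (b + 1)
        · have hpos : ∀ n < b, 0 < chord (iterJet (φ θ₀) n u₀).1 (iterJet (φ θ₀) b u₀).1 := by
            intro n hn
            have hc := hφ.isCircleLift ⟨θ₀, hθ₀⟩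
            obtain ⟨m, hm, e⟩ := hmem
            have hper := hc.minimalPeriod_eq (x := u₀) (m := m) (b := b + 1) hm (by
              rw [← iterJet_fst]; simp only at e; linarith)
            rw [chord_pos_iff, iterJet_fst, iterJet_fst, hc.lift_iterate, hc.lift_iterate]
            intro heq
            have := (Function.iterate_eq_iterate_iff_of_lt_minimalPeriod
              (by omega : n < Function.minimalPeriod _ _) (by omega)).1 heq
            omega
          obtain ⟨d, hd0, hd⟩ : ∃ d > 0, ∀ n ∈ Finset.range b,
              d < chord (iterJet (φ θ₀) n u₀).1 (iterJet (φ θ₀) b u₀).1 := by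
            have h1 : ∀ᶠ d : ℝ in 𝓝[>] 0, ∀ n ∈ Finset.range b,
                d < chord (iterJet (φ θ₀) n u₀).1 (iterJet (φ θ₀) b u₀).1 :=
              (eventually_all_finset _).2 fun n hn =>
                nhdsWithin_le_nhds (gt_mem_nhds (hpos n (Finset.mem_range.1 hn)))
            obtain ⟨d, h1, h2⟩ := (h1.and eventually_mem_nhdsWithin).exists
            exact ⟨d, h2, h1⟩
          refine ⟨d, hd0, ?_⟩
          have : ∀ᶠ z : (Family Λ × ℝ) × ℝ in (𝓝 F ×ˢ 𝓝[I] θ₀) ×ˢ 𝓝 u₀, ∀ n ∈ Finset.range b,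
              d < chord (iterJet (nearLift φ z.1.1 z.1.2) n z.2).1
                (iterJet (nearLift φ z.1.1 z.1.2) b z.2).1 :=
            (eventually_all_finset _).2 fun n hn =>
              ((continuous_chord.tendsto _).comp ((ht n).fst_nhds.prodMk_nhds
                (ht b).fst_nhds)).eventually (lt_mem_nhds (hd n hn))
          exact this.mono fun z hz _ n hn => (hz n (Finset.mem_range.2 hn)).le
        · refine ⟨1, one_pos, ?_⟩
          filter_upwards [((ht (b + 1)).fst_nhds.sub tendsto_snd).eventually
            ((isClosed_coprimeInts (b + 1)).isOpen_compl.mem_nhds hmem)] with z hz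
          exact fun h => absurd h hz
      obtain ⟨d, hd, hev⟩ := key
      obtain ⟨s, hs, v, hv, h⟩ := mem_prod_iff.1 hev
      obtain ⟨w, hw, t, ht, h'⟩ := mem_prod_iff.1 hs
      refine ⟨t ×ˢ v, ?_, d, hd, ?_⟩
      · rw [nhdsWithin_prod_eq]
        exact prod_mem_prod ht (nhdsWithin_le_nhds hv)
      · filter_upwards [hw] with a ha q hq
        exact @h ((a, q.1), q.2) ⟨h' ⟨ha, hq.1⟩, hq.2⟩
  obtain ⟨d, hd, h⟩ := this
  exact ⟨d, hd, h.mono fun a ha θ hθ u hu => ha (θ, u) ⟨hθ, hu⟩⟩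

theorem eventually_nearLift_eq_perturb {ι : Type*} [Fintype ι] {F : Family Λ} {φ : ℝ → ℝ → ℝ}
    (h0 : (0, 0) ∈ Λ) (hφ : IsFamilyLift Λ F.map φ) {P : ι → ℝ → ℝ}
    (hP : ∀ i, Continuous (P i)) (hper : ∀ i x, P i (x + 1) = P i x) {G : (ι → ℝ) → Family Λ}
    (hG : ∀ᶠ c in 𝓝 0, IsFamilyLift Λ (G c).map (perturb φ P c)) (hGF : Tendsto G (𝓝 0) (𝓝 F)) :
    ∀ᶠ c in 𝓝 0, ∀ θ ∈ I, nearLift φ (G c) θ = perturb φ P c θ := by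
  have h1 := hGF.eventually (Metric.tendstoUniformlyOn_iff.1
    (tendstoUniformlyOn_nearLift h0 hφ h0) (1 / 2) (by norm_num))
  filter_upwards [hG, h1, tendstoUniformly_sum_mul hP hper (ε := 1 / 2) (by norm_num)]
    with c h2 h3 h4 θ hθ
  obtain ⟨n, hn⟩ := (isFamilyLift_nearLift φ (G c)).eq_add_int h2 h0
  have h5 := h3 (θ, 0) ⟨hθ, mem_univ _⟩
  have h6 := h4 0
  simp only [iteratedDeriv_zero, hn θ hθ, Real.dist_eq, perturb] at h5
  rw [abs_lt] at h5 h6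
  have h7 : (n : ℝ) < 1 := by linarith
  have h8 : (-1 : ℝ) < n := by linarith
  have h9 : n = 0 := by
    have : n < 1 := by exact_mod_cast h7
    have : -1 < n := by exact_mod_cast h8
    omega
  ext x
  rw [hn θ hθ, h9]
  simp

theorem stripLipschitz_perturb {ι : Type*} [Fintype ι] {φ : ℝ → ℝ → ℝ} (hφ : IsLineFamily Λ φ)
    {P : ι → ℝ → ℝ} (hP : ∀ i, ∀ n : ℕ, ContDiff ℝ n (P i)) (hper : ∀ i x, P i (x + 1) = P i x)
    (c : ι → ℝ) {j : ℕ} (hj : (0, j) ∈ Λ)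
    (hL : StripLipschitz fun θ x => iteratedDeriv j (φ θ) x) :
    StripLipschitz fun θ x => iteratedDeriv j (perturb φ P c θ) x := by
  obtain ⟨K, hK, H⟩ := hL
  have hQ : ∀ n : ℕ, ContDiff ℝ n fun x => ∑ i, c i * P i x := fun n =>
    contDiff_sum_mul (fun i => hP i n) c
  have hQper : ∀ x, (fun x => ∑ i, c i * P i x) (x + 1) = (fun x => ∑ i, c i * P i x) x :=
    fun x => by simp only [hper]
  obtain ⟨B, hB⟩ := exists_abs_le_of_periodic
    (m := fun _ x => iteratedDeriv (j + 1) (fun x => ∑ i, c i * P i x) x)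
    (((hQ (j + 1)).continuous_iteratedDeriv' (j + 1)).comp continuous_snd).continuousOn
    (fun _ _ => iteratedDeriv_periodic hQper (j + 1))
  have hB0 : 0 ≤ B := (abs_nonneg _).trans (hB 0 zero_mem_I 0)
  refine ⟨K + B, by positivity, fun θ hθ θ' hθ' x x' => ?_⟩
  have h1 : |iteratedDeriv j (fun x => ∑ i, c i * P i x) x -
      iteratedDeriv j (fun x => ∑ i, c i * P i x) x'| ≤ B * |x - x'| := by
    refine convex_univ.norm_image_sub_le_of_norm_deriv_le
      (fun y _ => (hQ (j + 1)).differentiable_iteratedDeriv j (by exact_mod_cast Nat.lt_succ_self j) y)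
      (fun y _ => ?_) (mem_univ x') (mem_univ x)
    rw [← iteratedDeriv_succ]
    exact hB 0 zero_mem_I y
  have h2 := H θ hθ θ' hθ' x x'
  simp only [iteratedDeriv_sum_mul fun i => hP i j] at h1
  simp only [iteratedDeriv_perturb hφ hP c hj hθ, iteratedDeriv_perturb hφ hP c hj hθ']
  calc _ = |(iteratedDeriv j (φ θ) x - iteratedDeriv j (φ θ') x') +
        (∑ i, c i * iteratedDeriv j (P i) x - ∑ i, c i * iteratedDeriv j (P i) x')| := by ring_nf
    _ ≤ _ := abs_add_le _ _
    _ ≤ K * (|θ - θ'| + |x - x'|) + B * |x - x'| := add_le_add h2 h1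
    _ ≤ _ := by nlinarith [mul_nonneg hB0 (abs_nonneg (θ - θ'))]

theorem tendsto_iterJet_perturb {ι : Type*} [Fintype ι] {φ : ℝ → ℝ → ℝ} (hΛ : ∀ j ≤ 2, (0, j) ∈ Λ)
    (hφ : IsLineFamily Λ φ) {P : ι → ℝ → ℝ} (hP : ∀ i, ∀ n : ℕ, ContDiff ℝ n (P i)) (c₀ : ι → ℝ)
    {θ₀ : ℝ} (hθ₀ : θ₀ ∈ I) (n : ℕ) (u₀ : ℝ) :
    Tendsto (fun z : ((ι → ℝ) × ℝ) × ℝ => iterJet (perturb φ P z.1.1 z.1.2) n z.2)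
      ((𝓝 c₀ ×ˢ 𝓝[I] θ₀) ×ˢ 𝓝 u₀) (𝓝 (iterJet (perturb φ P c₀ θ₀) n u₀)) := by
  refine tendsto_iterJet (g := fun a : (ι → ℝ) × ℝ => perturb φ P a.1 a.2) (fun j hj y => ?_) n u₀
  rw [iteratedDeriv_perturb hφ hP c₀ (hΛ j hj) hθ₀]
  have hev : ∀ᶠ z : ((ι → ℝ) × ℝ) × ℝ in (𝓝 c₀ ×ˢ 𝓝[I] θ₀) ×ˢ 𝓝 y, z.1.2 ∈ I :=
    (tendsto_snd.comp tendsto_fst).eventually eventually_mem_nhdsWithin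
  refine Tendsto.congr' (hev.mono fun z hz =>
    (iteratedDeriv_perturb hφ hP z.1.1 (hΛ j hj) hz z.2).symm) ?_
  have t1 : Tendsto (fun z : ((ι → ℝ) × ℝ) × ℝ => z.1.2) ((𝓝 c₀ ×ˢ 𝓝[I] θ₀) ×ˢ 𝓝 y) (𝓝[I] θ₀) :=
    tendsto_snd.comp tendsto_fst
  have t2 : Tendsto (fun z : ((ι → ℝ) × ℝ) × ℝ => z.1.1) ((𝓝 c₀ ×ˢ 𝓝[I] θ₀) ×ˢ 𝓝 y) (𝓝 c₀) :=
    tendsto_fst.comp tendsto_fst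
  have t3 : Tendsto (fun z : ((ι → ℝ) × ℝ) × ℝ => z.2) ((𝓝 c₀ ×ˢ 𝓝[I] θ₀) ×ˢ 𝓝 y) (𝓝 y) :=
    tendsto_snd
  refine Tendsto.add ?_ (tendsto_finsetSum _ fun i _ => Tendsto.mul ?_ ?_)
  · have := hφ.continuousOn_iteratedDeriv (hΛ j hj) (θ₀, y) ⟨hθ₀, mem_univ _⟩
    rw [ContinuousWithinAt, nhdsWithin_prod_eq, nhdsWithin_univ] at this
    exact this.comp (t1.prodMk t3)
  · exact ((continuous_apply i).tendsto c₀).comp t2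
  · exact (((hP i j).continuous_iteratedDeriv' j).tendsto y).comp t3

/-- Shift of the coefficients with first index `a`. -/
def shiftCoeff {T : Finset ℝ} (a : T) (c : T × Fin 3 → ℝ) (s : Fin 3 → ℝ) : T × Fin 3 → ℝ :=
  fun i => c i + if i.1 = a then s i.2 else 0

theorem perturb_shiftCoeff {T : Finset ℝ} (φ : ℝ → ℝ → ℝ) (e : ℝ) (a : T) (c : T × Fin 3 → ℝ)
    (s : Fin 3 → ℝ) :
    perturb φ (fun i : T × Fin 3 => bumpTrig i.1 e i.2) (shiftCoeff a c s) =
      perturb (perturb φ (fun i : T × Fin 3 => bumpTrig i.1 e i.2) c) (bumpTrig a e) s := by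
  ext θ x
  simp only [perturb, shiftCoeff, add_mul, Finset.sum_add_distrib, add_assoc, ite_mul, zero_mul]
  congr 2
  rw [Fintype.sum_prod_type]
  simp only [Finset.sum_ite_irrel, Finset.sum_const_zero]
  rw [Finset.sum_ite_eq' Finset.univ a]
  simp

theorem continuous_shiftCoeff {T : Finset ℝ} (a : T) (c : T × Fin 3 → ℝ) :
    Continuous (shiftCoeff a c) := by
  refine continuous_pi fun i => ?_
  unfold shiftCoeff
  split_ifs <;> fun_prop

/-- Families without degenerate periodic points are dense. -/
theorem exists_family_not_isDegenerate (hΛ : IsLowerSet Λ) (h02 : (0, 2) ∈ Λ) (h10 : (1, 0) ∈ Λ)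
    (F : Family Λ) {U : Set (Family Λ)} (hU : U ∈ 𝓝 F) (b : ℕ) :
    ∃ G ∈ U, ∃ φ, IsFamilyLift Λ G.map φ ∧
      ∀ θ ∈ I, ∀ u ∈ Icc (0 : ℝ) 1, ¬ IsDegenerate (b + 1) (φ θ) u := by
  have hΛ2 : ∀ j ≤ 2, (0, j) ∈ Λ := fun j hj =>
    hΛ (show ((0, j) : ℕ × ℕ) ≤ (0, 2) from ⟨le_rfl, hj⟩) h02
  have h0 : (0, 0) ∈ Λ := hΛ2 0 (by norm_num)
  have h01 : (0, 1) ∈ Λ := hΛ2 1 (by norm_num)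
  obtain ⟨V, hVU, hV, hFV⟩ := mem_nhds_iff.1 hU
  obtain ⟨F₁, hF₁, φ, hφ, hL⟩ := exists_family_stripLipschitz hΛ h02 h10 F (hV.mem_nhds hFV)
  obtain ⟨d, hd, hsep⟩ := exists_eventually_isSeparated hΛ2 hφ b
  set e := d / 6 with he
  have he0 : 0 < e := by positivity
  have hde : d = 6 * e := by rw [he]; ring
  -- a finite set of centers of arcs covering the circle
  obtain ⟨T, hT⟩ : ∃ T : Finset ℝ, ∀ y : ℝ, ∃ a ∈ T, chord y a ≤ e / 2 := by
    obtain ⟨T, -, hT⟩ := (isCompact_Icc (a := (0 : ℝ)) (b := 1)).elim_nhds_subcover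
      (fun a => {y | chord y a < e / 2}) (fun a _ => by
        refine (isOpen_lt (f := fun y => chord y a) (by unfold chord; fun_prop)
          continuous_const).mem_nhds ?_
        have : chord a a = 0 := chord_eq_zero_iff.2 rfl
        simp only [mem_ofPred_eq, this]
        positivity)
    refine ⟨T, fun y => ?_⟩
    have := hT (show Int.fract y ∈ Icc (0 : ℝ) 1 from
      ⟨Int.fract_nonneg y, (Int.fract_lt_one y).le⟩)
    simp only [mem_iUnion] at this
    obtain ⟨a, ha, hlt⟩ := this
    refine ⟨a, ha, ?_⟩
    have h1 := add_int_of_add_one (g := fun y => chord y a) (c := 0)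
      (fun x => by rw [chord_add_one, add_zero]) (Int.fract y) ⌊y⌋
    simp only [Int.fract_add_floor, mul_zero, add_zero] at h1
    rw [h1]
    exact hlt.le
  let P : T × Fin 3 → ℝ → ℝ := fun i => bumpTrig i.1 e i.2
  have hP : ∀ i, ∀ n : ℕ, ContDiff ℝ n (P i) := fun i n => contDiff_bumpTrig _ _ _ n
  have hper : ∀ i x, P i (x + 1) = P i x := fun i x => bumpTrig_add_one _ _ _ x
  obtain ⟨G, hG, hGF⟩ := exists_perturbation h0 h01 hφ hP hper
  have hnear := eventually_nearLift_eq_perturb h0 hφ (fun i => (hP i 0).continuous) hper hG hGF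
  -- an open set of good parameters
  have hW : ∀ᶠ c in 𝓝 0, G c ∈ V ∧ IsFamilyLift Λ (G c).map (perturb φ P c) ∧
      ∀ θ ∈ I, ∀ u ∈ Icc (0 : ℝ) 1, IsSeparated b (6 * e) (perturb φ P c θ) u := by
    filter_upwards [hG, hnear, hGF.eventually hsep, hGF.eventually (hV.mem_nhds hF₁)]
      with c h1 h2 h3 h4
    refine ⟨h4, h1, fun θ hθ u hu => ?_⟩
    rw [← h2 θ hθ, ← hde]
    exact h3 θ hθ u hu
  obtain ⟨W, hWsub, hWo, hW0⟩ := eventually_nhds_iff.1 hW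
  let Good : T → Set (T × Fin 3 → ℝ) := fun a => {c | ∀ θ ∈ I, ∀ u ∈ Icc (0 : ℝ) 1,
    ¬ (IsDegenerate (b + 1) (perturb φ P c θ) u ∧
      chord (iterJet (perturb φ P c θ) b u).1 a ≤ e / 2)}
  have hopen : ∀ a, IsOpen (Good a) := by
    intro a
    rw [isOpen_iff_mem_nhds]
    intro c₀ hc₀
    refine eventually_forall_box (l := 𝓝 c₀) (p := fun z => ¬ (IsDegenerate (b + 1)
      (perturb φ P z.1.1 z.1.2) z.2 ∧ chord (iterJet (perturb φ P z.1.1 z.1.2) b z.2).1 a ≤ e / 2))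
      fun θ₀ hθ₀ u₀ hu₀ => ?_
    have t := fun n => tendsto_iterJet_perturb hΛ2 hφ.isLineFamily hP c₀ hθ₀ n u₀
    have hcl : IsClosed (coprimeInts (b + 1) ×ˢ (({(1, 0)} : Set (ℝ × ℝ)) ×ˢ Iic (e / 2))) :=
      (isClosed_coprimeInts _).prod (isClosed_singleton.prod isClosed_Iic)
    have ht := ((t (b + 1)).fst_nhds.sub tendsto_snd).prodMk_nhds ((t (b + 1)).snd_nhds.prodMk_nhds
      ((continuous_chord.tendsto _).comp ((t b).fst_nhds.prodMk_nhds (tendsto_const_nhds (x := (a : ℝ))))))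
    have hlim := hc₀ θ₀ hθ₀ u₀ hu₀
    filter_upwards [ht.eventually (hcl.isOpen_compl.mem_nhds fun hmem =>
      hlim ⟨⟨hmem.1, hmem.2.1⟩, hmem.2.2⟩)] with z hz hbad
    exact hz ⟨hbad.1.1, hbad.1.2, hbad.2⟩
  have hdense : ∀ a, ∀ O : Set (T × Fin 3 → ℝ), IsOpen O → O ⊆ W → O.Nonempty →
      (O ∩ Good a).Nonempty := by
    rintro a O hO hOW ⟨c, hc⟩
    have hc' := (hWsub c (hOW hc)).2.1
    have hD := dense_compl_degenSet (χ := perturb φ P c)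
      (fun j hj => stripLipschitz_perturb hφ.isLineFamily hP hper c (hΛ2 j hj) (hL j hj))
      (fun θ hθ => hc'.deriv_pos ⟨θ, hθ⟩) b
    have hs0 : shiftCoeff a c 0 = c := by ext i; simp [shiftCoeff]
    obtain ⟨s, hs, hsO⟩ := hD.exists_mem_open (hO.preimage (continuous_shiftCoeff a c))
      ⟨0, by rw [mem_preimage, hs0]; exact hc⟩
    refine ⟨shiftCoeff a c s, hsO, fun θ hθ u hu hbad => hs ?_⟩
    have hsep' := (hWsub _ (hOW hsO)).2.2 θ hθ u hu
    rw [show perturb φ P (shiftCoeff a c s) = perturb (perturb φ P c) (bumpTrig a e) s from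
      perturb_shiftCoeff φ e a c s] at hsep' hbad
    exact mem_degenSet hc'.isLineFamily hΛ2 he0 hθ hsep' hbad.1 hbad.2
  have hfin : ∀ A : Finset T, ∃ O : Set (T × Fin 3 → ℝ), IsOpen O ∧ O ⊆ W ∧ O.Nonempty ∧
      ∀ a ∈ A, O ⊆ Good a := by
    classical
    intro A
    induction A using Finset.induction_on with
    | empty => exact ⟨W, hWo, subset_rfl, ⟨0, hW0⟩, by simp⟩
    | insert a A _ ih =>
      obtain ⟨O, hO, hOW, hne, hgood⟩ := ih
      refine ⟨O ∩ Good a, hO.inter (hopen a), inter_subset_left.trans hOW, hdense a O hO hOW hne, ?_⟩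
      intro a' ha'
      rcases Finset.mem_insert.1 ha' with rfl | h
      · exact inter_subset_right
      · exact inter_subset_left.trans (hgood a' h)
  obtain ⟨O, -, hOW, ⟨c, hc⟩, hgood⟩ := hfin Finset.univ
  obtain ⟨h1, h2, -⟩ := hWsub c (hOW hc)
  refine ⟨G c, hVU h1, _, h2, fun θ hθ u hu hdeg => ?_⟩
  obtain ⟨a, ha, hle⟩ := hT (iterJet (perturb φ P c θ) b u).1
  exact hgood ⟨a, ha⟩ (Finset.mem_univ _) hc θ hθ u hu ⟨hdeg, hle⟩

/-! ### Local boundedness of the number of sources -/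

theorem exists_eventually_maxSources_le {F : Family Λ} {φ : ℝ → ℝ → ℝ} (hΛ : ∀ j ≤ 2, (0, j) ∈ Λ)
    (hφ : IsFamilyLift Λ F.map φ) {q : ℚ}
    (hb : ∀ θ ∈ I, ∀ u ∈ Icc (0 : ℝ) 1, ¬ IsDegenerate q.den (φ θ) u) :
    ∃ M : ℕ, ∀ᶠ G in 𝓝 F, Family.maxSources G ((q : ℝ) : S1) ≤ M := by
  obtain ⟨M, hM⟩ := exists_eventually_encard_le hΛ hφ hb
  refine ⟨M, hM.mono fun G hG => iSup₂_le fun θ hrot => ?_⟩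
  refine le_trans ?_ (hG θ θ.2)
  refine le_trans (encard_le_encard ?_)
    (encard_image_le (fun u : ℝ => range fun n : ℕ => (G.map θ)^[n] (u : S1)) _)
  rintro O ⟨x, hx, rfl⟩
  obtain ⟨v, rfl⟩ := QuotientAddGroup.mk_surjective x
  have hv : ((Int.fract v : ℝ) : S1) = v :=
    coe_eq_coe_iff.2 ⟨-⌊v⌋, by push_cast; rw [Int.fract]; ring⟩
  change IsSourcePoint _ (v : S1) at hx
  refine ⟨Int.fract v, ⟨⟨θ.2, Int.fract_nonneg v, (Int.fract_lt_one v).le⟩, ?_⟩, ?_⟩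
  · obtain ⟨m, hm, h, -⟩ := ((isFamilyLift_nearLift φ G).isCircleLift θ).exists_iterate_den_eq hrot
      (x := Int.fract v) (by rw [hv]; exact hx.1)
    exact ⟨m, hm, by simp only; linarith⟩
  · simp only [hv]

/-! ### Making sources hyperbolic -/

theorem exists_smooth_vanishing {S : Set S1} (hS : S.Finite) :
    ∃ P : ℝ → ℝ, (∀ n : ℕ, ContDiff ℝ n P) ∧ (∀ x, P (x + 1) = P x) ∧
      ∀ x : ℝ, (x : S1) ∈ S → P x = 0 ∧ 0 < deriv P x := by
  classical
  obtain ⟨σ, hσ⟩ : ∃ σ : S1 → ℝ, ∀ x, (σ x : S1) = x :=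
    ⟨_, fun x => (QuotientAddGroup.mk_surjective x).choose_spec⟩
  obtain ⟨e, he0, he⟩ : ∃ e > 0, ∀ a ∈ hS.toFinset, ∀ a' ∈ hS.toFinset, a ≠ a' →
      4 * e < chord (σ a) (σ a') := by
    have h1 : ∀ᶠ e : ℝ in 𝓝[>] 0, ∀ a ∈ hS.toFinset, ∀ a' ∈ hS.toFinset, a ≠ a' →
        4 * e < chord (σ a) (σ a') := by
      refine (eventually_all_finset _).2 fun a _ => (eventually_all_finset _).2 fun a' _ => ?_
      by_cases h : a = a'
      · simp [h]
      · have hpos : 0 < chord (σ a) (σ a') / 4 := by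
          have : 0 < chord (σ a) (σ a') := chord_pos_iff.2 (by rwa [hσ, hσ])
          positivity
        filter_upwards [nhdsWithin_le_nhds (gt_mem_nhds hpos)] with e he _
        linarith
    obtain ⟨e, h1, h2⟩ := (h1.and eventually_mem_nhdsWithin).exists
    exact ⟨e, h2, h1⟩
  let s : S1 → ℝ → ℝ := fun a x => Real.sin (2 * Real.pi * (x - σ a))
  have hs : ∀ a x, HasDerivAt (s a) (Real.cos (2 * Real.pi * (x - σ a)) * (2 * Real.pi)) x :=
    fun a x => by
      have : HasDerivAt (fun x : ℝ => 2 * Real.pi * (x - σ a)) (2 * Real.pi) x := by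
        simpa using ((hasDerivAt_id x).sub_const (σ a)).const_mul (2 * Real.pi)
      exact this.sin
  refine ⟨fun x => ∑ a ∈ hS.toFinset, bump (σ a) e x * s a x, fun n => ?_, fun x => ?_,
    fun x hx => ?_⟩
  · refine ContDiff.sum fun a _ => (contDiff_bump _ _ n).mul ?_
    exact Real.contDiff_sin.comp (by fun_prop)
  · refine Finset.sum_congr rfl fun a _ => ?_
    simp only [s]
    rw [bump_add_one, show 2 * Real.pi * (x + 1 - σ a) = 2 * Real.pi * (x - σ a) + 2 * Real.pi by ring,
      Real.sin_add_two_pi]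
  · have hmem : (x : S1) ∈ hS.toFinset := hS.mem_toFinset.2 hx
    have h0 : chord x (σ x) = 0 := chord_eq_zero_iff.2 (hσ _).symm
    have heq : (fun y => ∑ a ∈ hS.toFinset, bump (σ a) e y * s a y) =ᶠ[𝓝 x] s x := by
      have : ∀ᶠ y in 𝓝 x, ∀ a ∈ hS.toFinset, bump (σ a) e y = if a = x then 1 else 0 := by
        refine (eventually_all_finset _).2 fun a ha => ?_
        split_ifs with h
        · rw [h]
          exact bump_eventuallyEq_one he0 (by rw [h0]; exact he0)
        · refine bump_eventuallyEq_zero he0 ?_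
          have h1 := he x hmem a ha (Ne.symm h)
          have h2 := chord_le (σ x) x (σ a)
          rw [chord_comm (σ x) x, h0] at h2
          linarith
      filter_upwards [this] with y hy
      rw [Finset.sum_congr rfl fun a ha => by rw [hy a ha]]
      simp [hmem]
    have hcos : Real.cos (2 * Real.pi * (x - σ x)) = 1 := by
      unfold chord at h0; linarith
    have hsin : Real.sin (2 * Real.pi * (x - σ x)) = 0 := by
      have := Real.sin_sq_add_cos_sq (2 * Real.pi * (x - σ x))
      rw [hcos] at this
      nlinarith
    refine ⟨heq.eq_of_nhds.trans hsin, ?_⟩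
    rw [heq.deriv_eq, (hs x x).deriv, hcos]
    positivity

theorem finite_orbit {f : S1 ≃ₜ S1} {x : S1} (hx : x ∈ Function.periodicPts f) :
    (range fun n : ℕ => f^[n] x).Finite := by
  obtain ⟨p, hp, h⟩ := hx
  refine ((Finset.range p).finite_toSet.image fun n => f^[n] x).subset ?_
  rintro _ ⟨n, rfl⟩
  exact ⟨n % p, by simpa using Nat.mod_lt n hp, h.iterate_mod_apply n⟩

theorem orbit_iterate {f : S1 ≃ₜ S1} {x : S1} (hx : x ∈ Function.periodicPts f) (k : ℕ) :
    (range fun n : ℕ => f^[n] (f^[k] x)) = range fun n : ℕ => f^[n] x := by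
  obtain ⟨p, hp, h⟩ := hx
  refine Subset.antisymm ?_ ?_
  · rintro _ ⟨n, rfl⟩
    exact ⟨n + k, Function.iterate_add_apply _ _ _ _⟩
  · rintro _ ⟨n, rfl⟩
    refine ⟨n + (p * k - k), ?_⟩
    simp only
    rw [← Function.iterate_add_apply, add_assoc,
      Nat.sub_add_cancel (Nat.le_mul_of_pos_left k hp), Function.iterate_add_apply]
    congr 1
    exact h.mul_const k

/-- The sources of a member of a family can be made hyperbolic by a small perturbation. -/
theorem exists_family_hyperbolic (hΛ : ∀ j ≤ 2, (0, j) ∈ Λ) (F : Family Λ) (θ : I) {q : ℚ}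
    (hrot : HasRotationNumber (F.map θ) ((q : ℝ) : S1)) (hfin : (sources (F.map θ)).Finite)
    {U : Set (Family Λ)} (hU : U ∈ 𝓝 F) :
    ∃ G ∈ U, ∃ ψ, IsFamilyLift Λ G.map ψ ∧ ∀ x : ℝ, IsSourcePoint (F.map θ) x →
      (∀ n, (((ψ θ)^[n] x : ℝ) : S1) = (F.map θ)^[n] (x : S1)) ∧
      1 < (iterJet (ψ θ) q.den x).2.1 ∧
      ∃ m : ℤ, IsCoprime m q.den ∧ (ψ θ)^[q.den] x = x + m ∧ ∃ l : ℤ, m = q.num + l * q.den := by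
  have h0 : (0, 0) ∈ Λ := hΛ 0 (by norm_num)
  have h01 : (0, 1) ∈ Λ := hΛ 1 (by norm_num)
  have hφ := F.isFamilyLift_lift
  set φ := F.lift
  have hc := hφ.isCircleLift θ
  have hS : (⋃₀ sources (F.map θ)).Finite := hfin.sUnion (by
    rintro _ ⟨x, hx, rfl⟩; exact finite_orbit hx.1)
  obtain ⟨P, hP, hPper, hPS⟩ := exists_smooth_vanishing hS
  obtain ⟨G, hG, hGF⟩ := exists_perturbation (ι := Unit) (P := fun _ => P) h0 h01 hφ
    (fun _ => hP) (fun _ => hPper)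
  have htend : Tendsto (fun ε : ℝ => (fun _ : Unit => ε)) (𝓝[>] 0) (𝓝 0) := by
    have : Continuous (fun ε : ℝ => (fun _ : Unit => ε)) := by fun_prop
    exact (this.tendsto 0).mono_left nhdsWithin_le_nhds
  obtain ⟨ε, ⟨h1, h2⟩, h3⟩ := ((htend.eventually (hG.and (hGF.eventually hU))).and
    (eventually_mem_nhdsWithin (a := (0 : ℝ)) (s := Ioi 0))).exists
  have hε : 0 < ε := h3
  refine ⟨_, h2, _, h1, fun x hx => ?_⟩
  have hval : ∀ y, perturb φ (fun _ : Unit => P) (fun _ => ε) θ y = φ θ y + ε * P y := fun y => by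
    simp [perturb]
  have hder : ∀ y, deriv (perturb φ (fun _ : Unit => P) (fun _ => ε) θ) y =
      deriv (φ θ) y + ε * deriv P y := fun y => by
    have := iteratedDeriv_perturb hφ.isLineFamily (P := fun _ : Unit => P) (fun _ => hP)
      (fun _ => ε) h01 θ.2 y
    simpa [iteratedDeriv_one] using this
  have horb : ∀ n, (((φ θ)^[n] x : ℝ) : S1) ∈ ⋃₀ sources (F.map θ) := fun n =>
    ⟨_, ⟨x, hx, rfl⟩, n, (hc.lift_iterate n x).symm⟩
  set ψ := perturb φ (fun _ : Unit => P) (fun _ => ε) with hψ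
  have hiter : ∀ n, (ψ θ)^[n] x = (φ θ)^[n] x := by
    intro n
    induction n with
    | zero => rfl
    | succ n ih =>
      rw [Function.iterate_succ_apply', Function.iterate_succ_apply', ih, hval,
        (hPS _ (horb n)).1, mul_zero, add_zero]
  obtain ⟨m, hm, hmx, hl⟩ := hc.exists_iterate_den_eq hrot hx.1
  refine ⟨fun n => by rw [hiter, hc.lift_iterate], ?_, m, hm, by rw [hiter, hmx], hl⟩
  have hge : 1 ≤ (iterJet (φ θ) q.den x).2.1 := by
    refine hc.one_le_of_isAsymptoticallyStable hmx
      (hasDerivAt_iterate ((hφ.smooth 0 2 (hΛ 2 le_rfl)).contDiff_phase θ θ.2) q.den x) ?_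
    have := hx.2
    rwa [hc.minimalPeriod_eq hm hmx] at this
  refine hge.trans_lt ?_
  rw [iterJet_snd, iterJet_snd]
  refine Finset.prod_lt_prod_of_nonempty (fun i _ => hφ.deriv_pos θ _) (fun i _ => ?_)
    ⟨0, Finset.mem_range.2 q.den_pos⟩
  rw [hiter, hder]
  have := mul_pos hε (hPS _ (horb i)).2
  linarith

/-! ### Persistence of hyperbolic sources -/

theorem eventually_exists_source {F : Family Λ} {φ : ℝ → ℝ → ℝ} (hΛ : ∀ j ≤ 2, (0, j) ∈ Λ)
    (hφ : IsFamilyLift Λ F.map φ) (θ : I) {b : ℕ} (hb : 0 < b) {x : ℝ} {m : ℤ}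
    (hm : IsCoprime m b) (hx : (φ θ)^[b] x = x + m) (h1 : 1 < (iterJet (φ θ) b x).2.1)
    {Q : Family Λ × ℝ → Prop} (hQ : ∀ᶠ z in 𝓝 F ×ˢ 𝓝 x, Q z) :
    ∀ᶠ G in 𝓝 F, ∃ y : ℝ, Q (G, y) ∧ (nearLift φ G θ)^[b] y = y + m ∧
      IsSourcePoint (G.map θ) y := by
  have hC2 : ∀ G : Family Λ, ContDiff ℝ 2 (nearLift φ G θ) := fun G =>
    ((isFamilyLift_nearLift φ G).smooth 0 2 (hΛ 2 le_rfl)).contDiff_phase θ θ.2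
  have hC : ContDiff ℝ 2 (φ θ) := (hφ.smooth 0 2 (hΛ 2 le_rfl)).contDiff_phase θ θ.2
  have hmap : ∀ u, Tendsto (fun z : Family Λ × ℝ => ((z.1, (θ : ℝ)), z.2)) (𝓝 F ×ˢ 𝓝 u)
      ((𝓝 F ×ˢ 𝓝[I] (θ : ℝ)) ×ˢ 𝓝 u) := fun u =>
    (tendsto_fst.prodMk (tendsto_const_nhdsWithin θ.2)).prodMk tendsto_snd
  have ht : ∀ u, Tendsto (fun z : Family Λ × ℝ => iterJet (nearLift φ z.1 θ) b z.2) (𝓝 F ×ˢ 𝓝 u)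
      (𝓝 (iterJet (φ θ) b u)) := fun u => (tendsto_iterJet_nearLift hΛ hφ θ.2 b u).comp (hmap u)
  have hpos : ∀ᶠ z in 𝓝 F ×ˢ 𝓝 x, Q z ∧ 1 < (iterJet (nearLift φ z.1 θ) b z.2).2.1 :=
    hQ.and ((ht x).snd_nhds.fst_nhds.eventually (lt_mem_nhds h1))
  have hloc : ∀ᶠ u in 𝓝 x, 1 < (iterJet (φ θ) b u).2.1 :=
    (hasDerivAt_iterJet hC b x).2.continuousAt.eventually (lt_mem_nhds h1)
  obtain ⟨W, hW, v, hv, h⟩ := mem_prod_iff.1 hpos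
  obtain ⟨δ, hδ, hball⟩ := Metric.mem_nhds_iff.1 (inter_mem hv hloc)
  have hin : Icc (x - δ / 2) (x + δ / 2) ⊆ Metric.ball x δ := fun y hy => by
    rw [Metric.mem_ball, Real.dist_eq, abs_lt]
    constructor <;> linarith [hy.1, hy.2]
  have hmono : StrictMonoOn (fun u => (iterJet (φ θ) b u).1 - u) (Icc (x - δ / 2) (x + δ / 2)) := by
    have hd : ∀ u, HasDerivAt (fun u => (iterJet (φ θ) b u).1 - u) ((iterJet (φ θ) b u).2.1 - 1) u :=
      fun u => (hasDerivAt_iterJet hC b u).1.sub (hasDerivAt_id u)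
    refine strictMonoOn_of_deriv_pos (convex_Icc _ _)
      (fun u _ => (hd u).continuousAt.continuousWithinAt) fun u hu => ?_
    rw [(hd u).deriv, sub_pos]
    exact (hball (hin (interior_subset hu))).2
  have hxm : (iterJet (φ θ) b x).1 - x = m := by rw [iterJet_fst, hx]; ring
  have hl : (iterJet (φ θ) b (x - δ / 2)).1 - (x - δ / 2) < m := by
    rw [← hxm]
    exact hmono ⟨le_rfl, by linarith⟩ ⟨by linarith, by linarith⟩ (by linarith)
  have hr : m < (iterJet (φ θ) b (x + δ / 2)).1 - (x + δ / 2) := by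
    rw [← hxm]
    exact hmono ⟨by linarith, by linarith⟩ ⟨by linarith, le_rfl⟩ (by linarith)
  have hpt : ∀ u, Tendsto (fun G : Family Λ => (iterJet (nearLift φ G θ) b u).1 - u) (𝓝 F)
      (𝓝 ((iterJet (φ θ) b u).1 - u)) := fun u =>
    (((ht u).comp (tendsto_id.prodMk tendsto_const_nhds)).fst_nhds).sub tendsto_const_nhds
  filter_upwards [hW, (hpt _).eventually (gt_mem_nhds hl), (hpt _).eventually (lt_mem_nhds hr)]
    with G hG hGl hGr
  have hcont : ContinuousOn (fun u => (iterJet (nearLift φ G θ) b u).1 - u)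
      (Icc (x - δ / 2) (x + δ / 2)) := fun u _ =>
    ((hasDerivAt_iterJet (hC2 G) b u).1.continuousAt.sub continuousAt_id).continuousWithinAt
  obtain ⟨y, hy, hym⟩ := intermediate_value_Icc (by linarith) hcont ⟨hGl.le, hGr.le⟩
  obtain ⟨hQy, hy1⟩ := @h (G, y) ⟨hG, (hball (hin hy)).1⟩
  have hyx : (nearLift φ G θ)^[b] y = y + m := by
    simp only [iterJet_fst] at hym
    linarith
  exact ⟨y, hQy, hyx, ((isFamilyLift_nearLift φ G).isCircleLift θ).isSourcePoint_of_one_lt hb hm hyx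
    (hasDerivAt_iterate (hC2 G) b y) hy1⟩

/-- Sources can be made persistent by a small perturbation. -/
theorem exists_family_eventually_le_maxSources (hΛ : ∀ j ≤ 2, (0, j) ∈ Λ) (F : Family Λ) (θ : I)
    {q : ℚ} (hrot : HasRotationNumber (F.map θ) ((q : ℝ) : S1))
    (hfin : (sources (F.map θ)).Finite) {U : Set (Family Λ)} (hU : U ∈ 𝓝 F) :
    ∃ G ∈ U, ∀ᶠ G' in 𝓝 G,
      (sources (F.map θ)).encard ≤ Family.maxSources G' ((q : ℝ) : S1) := by
  obtain ⟨G, hGU, ψ, hψ, H⟩ := exists_family_hyperbolic hΛ F θ hrot hfin hU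
  refine ⟨G, hGU, ?_⟩
  rcases (sources (F.map θ)).eq_empty_or_nonempty with hemp | ⟨O₀, hO₀⟩
  · simp [hemp]
  have hrep : ∀ O ∈ sources (F.map θ), ∃ x : ℝ, IsSourcePoint (F.map θ) (x : S1) ∧
      O = range fun n : ℕ => (F.map θ)^[n] (x : S1) := by
    rintro O ⟨x, hx, rfl⟩
    obtain ⟨v, rfl⟩ := QuotientAddGroup.mk_surjective x
    exact ⟨v, hx, rfl⟩
  choose! ξ hξ hξO using hrep
  have hS : (⋃₀ sources (F.map θ)).Finite := hfin.sUnion (by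
    rintro _ ⟨x, hx, rfl⟩; exact finite_orbit hx.1)
  obtain ⟨V, hV, hdisj⟩ := hS.t2_separation
  have hmemS : ∀ O ∈ sources (F.map θ), ∀ n, (F.map θ)^[n] (ξ O : S1) ∈ ⋃₀ sources (F.map θ) :=
    fun O hO n => ⟨O, hO, by rw [hξO O hO]; exact ⟨n, by rw [← hξO O hO]⟩⟩
  have key : ∀ O ∈ sources (F.map θ), ∀ᶠ G' in 𝓝 G, ∃ y : ℝ,
      (∀ n ∈ Finset.range q.den, (G'.map θ)^[n] (y : S1) ∈ V ((F.map θ)^[n] (ξ O : S1))) ∧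
      (∃ m l : ℤ, m = q.num + l * q.den ∧ (nearLift ψ G' θ)^[q.den] y = y + m) ∧
      IsSourcePoint (G'.map θ) y := by
    intro O hO
    obtain ⟨h1, h2, m, hm, hmx, l, hl⟩ := H (ξ O) (hξ O hO)
    have hQ : ∀ᶠ z : Family Λ × ℝ in 𝓝 G ×ˢ 𝓝 (ξ O), ∀ n ∈ Finset.range q.den,
        (z.1.map θ)^[n] (z.2 : S1) ∈ V ((F.map θ)^[n] (ξ O : S1)) := by
      refine (eventually_all_finset _).2 fun n _ => ?_
      have ht : Tendsto (fun z : Family Λ × ℝ => ((iterJet (nearLift ψ z.1 θ) n z.2).1 : S1))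
          (𝓝 G ×ˢ 𝓝 (ξ O)) (𝓝 ((iterJet (ψ θ) n (ξ O)).1 : S1)) :=
        ((AddCircle.continuous_mk' (1 : ℝ)).tendsto _).comp
          ((tendsto_iterJet_nearLift hΛ hψ θ.2 n (ξ O)).comp
            ((tendsto_fst.prodMk (tendsto_const_nhdsWithin θ.2)).prodMk tendsto_snd)).fst_nhds
      rw [iterJet_fst, h1 n] at ht
      filter_upwards [ht.eventually ((hV _).2.mem_nhds (hV _).1)] with z hz
      rwa [iterJet_fst, ((isFamilyLift_nearLift ψ z.1).isCircleLift θ).lift_iterate] at hz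
    filter_upwards [eventually_exists_source hΛ hψ θ q.den_pos hm hmx h2 hQ] with G' hG'
    obtain ⟨y, hy1, hy2, hy3⟩ := hG'
    exact ⟨y, hy1, ⟨m, l, hl, hy2⟩, hy3⟩
  filter_upwards [(eventually_all_finite hfin).2 key] with G' hG'
  choose! y hyV hym hyS using hG'
  have hc := (isFamilyLift_nearLift ψ G').isCircleLift θ
  have hrot' : HasRotationNumber (G'.map θ) ((q : ℝ) : S1) := by
    obtain ⟨m, l, hl, hm⟩ := hym O₀ hO₀
    exact hc.hasRotationNumber hl hm
  refine le_trans ?_ (le_iSup₂ (f := fun (θ : I) (_ : HasRotationNumber (G'.map θ) ((q : ℝ) : S1)) =>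
    (sources (G'.map θ)).encard) θ hrot')
  have hinj : InjOn (fun O => range fun n : ℕ => (G'.map θ)^[n] (y O : S1)) (sources (F.map θ)) := by
    intro O hO O' hO' heq
    have hmem : (y O' : S1) ∈ range fun n : ℕ => (G'.map θ)^[n] (y O : S1) := by
      simp only at heq
      rw [heq]
      exact ⟨0, rfl⟩
    obtain ⟨n, hn⟩ := hmem
    have hper : Function.IsPeriodicPt (G'.map θ) q.den (y O : S1) := by
      obtain ⟨m, l, -, hm⟩ := hym O hO
      exact hc.isPeriodicPt_iff.2 ⟨m, hm⟩
    simp only at hn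
    rw [← hper.iterate_mod_apply n] at hn
    have a1 := hyV O hO (n % q.den) (Finset.mem_range.2 (Nat.mod_lt n q.den_pos))
    have a2 := hyV O' hO' 0 (Finset.mem_range.2 q.den_pos)
    rw [hn] at a1
    have heq2 : (F.map θ)^[n % q.den] (ξ O : S1) = (F.map θ)^[0] (ξ O' : S1) := by
      by_contra hne
      exact disjoint_left.1 (hdisj (hmemS O hO _) (hmemS O' hO' _) hne) a1 a2
    rw [hξO O hO, hξO O' hO', ← orbit_iterate (hξ O hO).1 (n % q.den), heq2]
    rfl
  rw [← hinj.encard_image]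
  refine encard_le_encard ?_
  rintro _ ⟨O, hO, rfl⟩
  exact ⟨_, hyS O hO, rfl⟩

/-! ### Density -/

/-- The families at which `maxSources` is finite and locally constant are dense. -/
theorem dense_eventually_maxSources_eq (hΛ : IsLowerSet Λ) (h02 : (0, 2) ∈ Λ) (h10 : (1, 0) ∈ Λ)
    (q : ℚ) : Dense {F : Family Λ | F.maxSources ((q : ℝ) : S1) ≠ ⊤ ∧
      ∀ᶠ G in 𝓝 F, Family.maxSources G ((q : ℝ) : S1) = F.maxSources ((q : ℝ) : S1)} := by
  have hΛ2 : ∀ j ≤ 2, (0, j) ∈ Λ := fun j hj =>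
    hΛ (show ((0, j) : ℕ × ℕ) ≤ (0, 2) from ⟨le_rfl, hj⟩) h02
  rw [dense_iff_inter_open]
  rintro U hU ⟨F, hF⟩
  obtain ⟨b, hb⟩ : ∃ b, q.den = b + 1 := ⟨q.den - 1, by have := q.den_pos; omega⟩
  obtain ⟨F₁, hF₁, φ, hφ, hdeg⟩ := exists_family_not_isDegenerate hΛ h02 h10 F (hU.mem_nhds hF) b
  rw [← hb] at hdeg
  obtain ⟨M, hM⟩ := exists_eventually_maxSources_le hΛ2 hφ hdeg
  obtain ⟨V, hVM, hVo, hF₁V⟩ := eventually_nhds_iff.1 (hM.and (hU.mem_nhds hF₁))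
  let S : Set ℕ := {n | ∃ G ∈ V, Family.maxSources G ((q : ℝ) : S1) = n}
  have hlift : ∀ G ∈ V, ∃ n ∈ S, Family.maxSources G ((q : ℝ) : S1) = n := fun G hG => by
    have hne : Family.maxSources G ((q : ℝ) : S1) ≠ ⊤ :=
      ((hVM G hG).1.trans_lt (ENat.natCast_lt_top M)).ne
    obtain ⟨n, hn⟩ := ENat.ne_top_iff_exists.1 hne
    exact ⟨n, ⟨G, hG, hn.symm⟩, hn.symm⟩
  have hSb : BddAbove S := ⟨M, by
    rintro n ⟨G, hG, hn⟩
    have := (hVM G hG).1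
    rw [hn] at this
    exact_mod_cast this⟩
  have hSne : S.Nonempty := by
    obtain ⟨n, hn, -⟩ := hlift F₁ hF₁V
    exact ⟨n, hn⟩
  obtain ⟨F₂, hF₂, hmax⟩ := Nat.sSup_mem hSne hSb
  set N := sSup S
  have hle : ∀ G ∈ V, Family.maxSources G ((q : ℝ) : S1) ≤ N := fun G hG => by
    obtain ⟨n, hn, e⟩ := hlift G hG
    rw [e]
    exact_mod_cast le_csSup hSb hn
  have hfinish : ∀ G ∈ V, (∀ᶠ G' in 𝓝 G, (N : ℕ∞) ≤ Family.maxSources G' ((q : ℝ) : S1)) →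
      (U ∩ {F : Family Λ | F.maxSources ((q : ℝ) : S1) ≠ ⊤ ∧
      ∀ᶠ G in 𝓝 F, Family.maxSources G ((q : ℝ) : S1) = F.maxSources ((q : ℝ) : S1)}).Nonempty := by
    intro G hG hev
    have hGN : Family.maxSources G ((q : ℝ) : S1) = N := le_antisymm (hle G hG) hev.self_of_nhds
    refine ⟨G, (hVM G hG).2, by rw [hGN]; exact ENat.natCast_ne_top N, ?_⟩
    filter_upwards [hev, hVo.mem_nhds hG] with G' h1 h2
    rw [hGN]
    exact le_antisymm (hle G' h2) h1
  rcases Nat.eq_zero_or_pos N with h0 | hpos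
  · exact hfinish F₂ hF₂ (by simp [h0])
  · obtain ⟨n, hn⟩ : ∃ n, N = n + 1 := ⟨N - 1, by omega⟩
    obtain ⟨θ, hrot, hθ⟩ : ∃ θ : I, HasRotationNumber (F₂.map θ) ((q : ℝ) : S1) ∧
        (N : ℕ∞) ≤ (sources (F₂.map θ)).encard := by
      by_contra! hcon
      have : Family.maxSources F₂ ((q : ℝ) : S1) ≤ n := iSup₂_le fun θ hrot => by
        have := hcon θ hrot
        rw [hn] at this
        push_cast at this
        exact Order.le_of_lt_add_one this
      rw [hmax, hn] at this
      have h' : n + 1 ≤ n := by exact_mod_cast this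
      omega
    have hfin : (sources (F₂.map θ)).Finite := by
      refine finite_of_encard_le_coe (k := N) (le_trans ?_ hmax.le)
      exact le_iSup₂ (f := fun (θ : I) (_ : HasRotationNumber (F₂.map θ) ((q : ℝ) : S1)) =>
        (sources (F₂.map θ)).encard) θ hrot
    obtain ⟨G, hG, hev⟩ := exists_family_eventually_le_maxSources hΛ2 F₂ θ hrot hfin
      (hVo.mem_nhds hF₂)
    exact hfinish G hG (hev.mono fun G' h => hθ.trans h)

end CircleFamilies

end

theorem mainTheorem6 (k r : ℕ∞) (hk : 1 ≤ k) (hkr : k ≤ r) (hr : 2 ≤ r)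
    (Λ : Set (ℕ × ℕ)) (hΛ : CircleFamilies.IsOrderSet k r Λ) :
    ∃ R ∈ residual (CircleFamilies.Family Λ), ∀ F ∈ R, ∀ q : ℚ,
      F.maxSources (((q : ℝ)) : CircleFamilies.S1) ≠ ⊤ ∧
      ∀ᶠ G in 𝓝 F, CircleFamilies.Family.maxSources G (((q : ℝ)) : CircleFamilies.S1) =
        F.maxSources (((q : ℝ)) : CircleFamilies.S1) := by
  have h02 : (0, 2) ∈ Λ := (hΛ.phase_mem_iff 2).2 (by exact_mod_cast hr)
  have h10 : (1, 0) ∈ Λ := (hΛ.param_mem_iff 1).2 (by exact_mod_cast hk)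
  refine ⟨⋂ q : ℚ, {F : CircleFamilies.Family Λ | F.maxSources ((q : ℝ) : CircleFamilies.S1) ≠ ⊤ ∧
      ∀ᶠ G in 𝓝 F, CircleFamilies.Family.maxSources G ((q : ℝ) : CircleFamilies.S1) =
        F.maxSources ((q : ℝ) : CircleFamilies.S1)}, ?_, fun F hF q => mem_iInter.1 hF q⟩
  refine countable_iInter_mem.2 fun q => residual_of_dense_open ?_
    (CircleFamilies.dense_eventually_maxSources_eq hΛ.isLowerSet h02 h10 q)
  rw [isOpen_iff_mem_nhds]
  rintro F ⟨hF, hev⟩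
  filter_upwards [hev, eventually_eventually_nhds.2 hev] with G h1 h2
  refine ⟨by rw [h1]; exact hF, ?_⟩
  filter_upwards [h2] with G' h3
  rw [h3, h1]
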